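/- Let $p$ be a prime and $k$ an algebraically closed field of characteristic $p$. The Radford algebra $R(p)$ is the Hopf algebra over $k$ generated as an algebra by $g,x$ with relations $g^p=1$, $x^p=x$, $gx-xg=g^2-g$ (for $p=2$ the right-hand side of the last relation is $1-g$, since $g^2=1$), with comultiplication $\Delta(g)=g\otimes g$, $\Delta(x)=x\otimes 1+g\otimes x$ and counit $\varepsilon(g)=1$, $\varepsilon(x)=0$. For a finite-dimensional Hopf algebra $H$ over $k$ with unit map $u$, multiplication $m$ and antipode $S$, let $P_0=u\circ\varepsilon$ and, for $n\ge 1$, let $P_n(h)=\sum h_{(1)}h_{(2)}\cdots h_{(n)}$ be the $n$-th Sweedler power, and for $n\ge1$ let $$\nu_n(H)=\operatorname{Tr}(S\circ P_{n-1})\in k$$ be the $n$-th Frobenius–Schur indicator of $H$. Then $R(p)$ is finite-dimensional, and for every $n\ge 1$ $$\nu_n(R(p))=\begin{cases}1 & \text{if } p\nmid n,\\ 0 & \text{if } p\mid n.\end{cases}$$ So the sequence $(\nu_n(R(p)))_{n\ge1}$ is $1,\dots,1,0$ ($p-1$ ones) repeated with period $p$, that is, $\nu_{n+p}(R(p))=\nu_n(R(p))$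 for all $n\ge1$. Moreover the sequence is a gauge invariant: if $K$ is a finite-dimensional Hopf algebra over $k$ such that the categories $\mathrm{Rep}(R(p))$ and $\mathrm{Rep}(K)$ of finite-dimensional representations are equivalent as $k$-linear monoidal categories, then $\nu_n(K)=\nu_n(R(p))$ for all $n\ge 1$. -/

import Mathlib

universe u v w

open scoped TensorProduct

namespace RadfordIndicator

section FallingFactorials

open Polynomial in
lemma descPochhammer_char (k : Type u) [Field k] (p : ℕ) [Fact p.Prime] [CharP k p] :
    descPochhammer k p = X ^ p - X := by
  have hp : p.Prime := Fact.out
  classical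
  let s : Finset k := (Finset.range p).image (fun i : ℕ => (i : k))
  have hs : s.card = p := by
    rw [Finset.card_image_of_injOn, Finset.card_range]
    intro a ha b hb hab
    simp only [Finset.coe_range] at ha hb
    exact CharP.natCast_injOn_Iio k p ha hb hab
  have hX : (X ^ p - X : k[X]).degree = p := by
    rw [degree_sub_eq_left_of_degree_lt] <;> simp [hp.one_lt]
  have hXm : (X ^ p - X : k[X]).leadingCoeff = 1 := by
    rw [leadingCoeff, FiniteField.X_pow_card_sub_X_natDegree_eq k hp.one_lt]
    simp [coeff_X, hp.one_lt.ne]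
  have hm := monic_descPochhammer k p
  have hd : (descPochhammer k p).degree = p := by
    rw [degree_eq_natDegree hm.ne_zero, descPochhammer_natDegree]
  apply eq_of_degree_sub_lt_of_eval_finset_eq s
  · have := degree_sub_lt_left (p := descPochhammer k p) (q := X ^ p - X) (by rw [hd, hX])
      hm.ne_zero (by rw [hm.leadingCoeff, hXm])
    rwa [hs, ← hd]
  · intro x hx
    obtain ⟨i, hi, rfl⟩ := Finset.mem_image.1 hx
    rw [descPochhammer_eval_coe_nat_of_lt (Finset.mem_range.1 hi)]
    have := map_natCast (frobenius k p) i
    rw [frobenius_def] at this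
    simp [this]

end FallingFactorials

section Powers

variable {A : Type v} [Ring A]

lemma comm_pow {G X : A} (hc : G * X - X * G = G ^ 2 - G) (n : ℕ) :
    X * G ^ n = G ^ n * X - n * G ^ (n + 1) + n * G ^ n := by
  induction n with
  | zero => simp
  | succ n ih =>
    have h : X * G = G * X - G ^ 2 + G := by rw [← sub_sub_self (G * X) (X * G), hc]; abel
    have e : G ^ n * (G * X - G ^ 2 + G) = G ^ (n+1) * X - G ^ (n+2) + G ^ (n+1) := by
      rw [mul_add, mul_sub, ← mul_assoc, ← pow_succ, ← pow_add]
    calc X * G ^ (n+1) = (X * G ^ n) * G := by rw [pow_succ, mul_assoc]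
      _ = G ^ n * (X * G) - n * G ^ (n+2) + n * G ^ (n+1) := by
        rw [ih, add_mul, sub_mul]; simp only [mul_assoc, ← pow_succ]
      _ = _ := by
        rw [h, e]; push_cast; simp only [add_mul, one_mul]; abel

open Polynomial in
lemma falling_eq (k : Type u) [Field k] [Algebra k A] {G h X y : A} (hG : G * h = 1)
    (hc : G * X - X * G = G ^ 2 - G) (hyG : Commute y G) (n : ℕ) :
    aeval (X + y * G) (descPochhammer k n) = G ^ n * aeval (h * X + y) (descPochhammer k n) := by
  induction n with
  | zero => simp
  | succ n ih =>
    rw [descPochhammer_succ_right, mul_comm, map_mul, map_mul, ih, ← mul_assoc, ← mul_assoc]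
    congr 1
    simp only [map_sub, aeval_X, map_natCast]
    have h1 : G ^ (n + 1) * (h * X) = G ^ n * X := by
      rw [pow_succ, mul_assoc, ← mul_assoc G h, hG, one_mul]
    rw [sub_mul, add_mul, comm_pow hc, mul_sub, mul_add, h1, mul_assoc y, ← pow_succ',
      (hyG.pow_right (n + 1)).eq, ← (Nat.cast_commute n (G ^ (n+1))).eq]
    abel

/-- The `p`-th power of `X + y G` when `y` is central. -/
lemma pow_char_sub (k : Type u) [Field k] (p : ℕ) [Fact p.Prime] [CharP k p] [Algebra k A]
    {G h X y : A} (hG : G * h = 1) (hGp : G ^ p = 1)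
    (hc : G * X - X * G = G ^ 2 - G) (hyG : Commute y G) :
    (X + y * G) ^ p - (X + y * G) = (h * X + y) ^ p - (h * X + y) := by
  have := falling_eq k hG hc hyG p
  simpa [descPochhammer_char, hGp] using this

lemma pow_char_hX (k : Type u) [Field k] (p : ℕ) [Fact p.Prime] [CharP k p] [Algebra k A]
    {G h X : A} (hG : G * h = 1) (hGp : G ^ p = 1) (hXp : X ^ p = X)
    (hc : G * X - X * G = G ^ 2 - G) : (h * X) ^ p = h * X := by
  have := pow_char_sub k p hG hGp hc (Commute.zero_left G)
  rw [← sub_eq_zero]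
  simpa [hXp] using this.symm

lemma pow_char_add (k : Type u) [Field k] (p : ℕ) [Fact p.Prime] [CharP k p] [Algebra k A]
    {G h X y : A} (hG : G * h = 1) (hGp : G ^ p = 1) (hXp : X ^ p = X) (hyp : y ^ p = y)
    (hc : G * X - X * G = G ^ 2 - G) (hyG : Commute y G) (hyX : Commute y (h * X)) :
    (X + y * G) ^ p = X + y * G := by
  nontriviality A
  have : CharP A p := charP_of_injective_algebraMap (algebraMap k A).injective p
  rw [← sub_eq_zero, pow_char_sub k p hG hGp hc hyG, add_pow_char_of_commute _ hyX.symm,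
    pow_char_hX k p hG hGp hXp hc, hyp, sub_self]

end Powers

/-! ### The Radford algebra -/

/-- The two generators. -/
inductive Gen : Type
  | g
  | x

/-- The defining relations `g ^ p = 1`, `x ^ p = x`, `[g, x] = g ^ 2 - g` on the free algebra
`k⟨g, x⟩`. For `p = 2` the right-hand side of the last one is `1 - g`, because `g ^ 2 = 1`. -/
inductive RadfordRel (k : Type u) [Field k] (p : ℕ) :
    FreeAlgebra k Gen → FreeAlgebra k Gen → Prop
  | g_pow : RadfordRel k p (FreeAlgebra.ι k Gen.g ^ p) 1
  | x_pow : RadfordRel k p (FreeAlgebra.ι k Gen.x ^ p) (FreeAlgebra.ι k Gen.x)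
  | comm : RadfordRel k p
      (FreeAlgebra.ι k Gen.g * FreeAlgebra.ι k Gen.x - FreeAlgebra.ι k Gen.x * FreeAlgebra.ι k Gen.g)
      (FreeAlgebra.ι k Gen.g ^ 2 - FreeAlgebra.ι k Gen.g)

/-- The Radford algebra `R(p)` over `k`: the quotient of `k⟨g, x⟩` by the two-sided ideal generated
by the defining relations. -/
def Radford (k : Type u) [Field k] (p : ℕ) : Type u := RingQuot (RadfordRel k p)

namespace Radford

noncomputable section

variable (k : Type u) [Field k] (p : ℕ)

instance : Ring (Radford k p) := inferInstanceAs (Ring (RingQuot (RadfordRel k p)))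

instance : Algebra k (Radford k p) := inferInstanceAs (Algebra k (RingQuot (RadfordRel k p)))

/-- The quotient map from the free algebra. -/
def mk : FreeAlgebra k Gen →ₐ[k] Radford k p := RingQuot.mkAlgHom k (RadfordRel k p)

/-- The generator `g` of `R(p)`. -/
def g : Radford k p := mk k p (FreeAlgebra.ι k Gen.g)

/-- The generator `x` of `R(p)`. -/
def x : Radford k p := mk k p (FreeAlgebra.ι k Gen.x)

lemma mk_surjective : Function.Surjective (mk k p) := RingQuot.mkAlgHom_surjective k _

lemma g_pow : g k p ^ p = 1 := by
  have := RingQuot.mkAlgHom_rel k (RadfordRel.g_pow (k := k) (p := p))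
  rw [map_pow, map_one] at this
  exact this

lemma x_pow : x k p ^ p = x k p := by
  have := RingQuot.mkAlgHom_rel k (RadfordRel.x_pow (k := k) (p := p))
  rw [map_pow] at this
  exact this

lemma comm : g k p * x k p - x k p * g k p = g k p ^ 2 - g k p := by
  have := RingQuot.mkAlgHom_rel k (RadfordRel.comm (k := k) (p := p))
  simp only [map_sub, map_mul, map_pow] at this
  exact this

variable {k p}

/-- Algebra maps out of `R(p)`. -/
def lift {A : Type v} [Ring A] [Algebra k A] (a b : A) (ha : a ^ p = 1) (hb : b ^ p = b)
    (hab : a * b - b * a = a ^ 2 - a) : Radford k p →ₐ[k] A :=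
  RingQuot.liftAlgHom k (s := RadfordRel k p) ⟨FreeAlgebra.lift k (fun
    | Gen.g => a
    | Gen.x => b), by
      intro u v h
      cases h <;> simp [ha, hb, hab]⟩

section
variable {A : Type v} [Ring A] [Algebra k A] (a b : A) (ha : a ^ p = 1) (hb : b ^ p = b)
    (hab : a * b - b * a = a ^ 2 - a)

@[simp] lemma lift_g : lift a b ha hb hab (g k p) = a := by
  rw [lift, g, mk]
  exact (RingQuot.liftAlgHom_mkAlgHom_apply k _ _ _).trans (by simp)

@[simp] lemma lift_x : lift a b ha hb hab (x k p) = b := by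
  rw [lift, x, mk]
  exact (RingQuot.liftAlgHom_mkAlgHom_apply k _ _ _).trans (by simp)

end

lemma algHom_ext {A : Type v} [Semiring A] [Algebra k A] {f f' : Radford k p →ₐ[k] A}
    (hg : f (g k p) = f' (g k p)) (hx : f (x k p) = f' (x k p)) : f = f' := by
  apply RingQuot.ringQuot_ext'
  apply FreeAlgebra.hom_ext
  funext i
  cases i
  · exact hg
  · exact hx

/-- An induction principle: `R(p)` is generated by `g` and `x`. -/
lemma induct {P : Radford k p → Prop} (hk : ∀ r : k, P (algebraMap k _ r)) (hg : P (g k p))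
    (hx : P (x k p)) (hadd : ∀ a b, P a → P b → P (a + b)) (hmul : ∀ a b, P a → P b → P (a * b))
    (a : Radford k p) : P a := by
  obtain ⟨a, rfl⟩ := mk_surjective k p a
  induction a with
  | grade0 r => simpa using hk r
  | grade1 i => cases i
                · exact hg
                · exact hx
  | add a b ha hb => simpa using hadd _ _ ha hb
  | mul a b ha hb => simpa using hmul _ _ ha hb

section Hopf

variable (k p)

/-- The inverse of `g`. -/
def gInv : Radford k p := g k p ^ (p - 1)

lemma gInv_pow : gInv k p ^ p = 1 := by
  rw [gInv, ← pow_mul, mul_comm, pow_mul, g_pow, one_pow]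

variable [Fact p.Prime]

lemma g_mul_gInv : g k p * gInv k p = 1 := by
  rw [gInv, ← pow_succ', Nat.sub_add_cancel (Fact.out : p.Prime).one_le, g_pow]

lemma gInv_mul_g : gInv k p * g k p = 1 := by
  rw [gInv, ← pow_succ, Nat.sub_add_cancel (Fact.out : p.Prime).one_le, g_pow]

lemma x_mul_gInv : x k p * gInv k p = gInv k p * x k p + 1 - gInv k p := by
  have h := congrArg (fun t => gInv k p * t * gInv k p) (comm k p)
  have e1 : gInv k p * (g k p * x k p - x k p * g k p) * gInv k p
      = x k p * gInv k p - gInv k p * x k p := by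
    rw [mul_sub, ← mul_assoc, gInv_mul_g, one_mul, sub_mul, mul_assoc, mul_assoc, g_mul_gInv,
      mul_one]
  have e2 : gInv k p * (g k p ^ 2 - g k p) * gInv k p = 1 - gInv k p := by
    rw [mul_sub, pow_two, ← mul_assoc, gInv_mul_g, one_mul, sub_mul, one_mul, g_mul_gInv]
  have h' := e1.symm.trans (h.trans e2)
  rw [sub_eq_iff_eq_add] at h'
  rw [h']
  abel

/-- The counit: `g ↦ 1`, `x ↦ 0`. -/
def counitHom : Radford k p →ₐ[k] k :=
  lift 1 0 (one_pow p) (zero_pow (Fact.out : p.Prime).ne_zero) (by simp)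

@[simp] lemma counitHom_g : counitHom k p (g k p) = 1 := lift_g ..
@[simp] lemma counitHom_x : counitHom k p (x k p) = 0 := lift_x ..

variable [CharP k p]

/-- The comultiplication: `g ↦ g ⊗ g`, `x ↦ x ⊗ 1 + g ⊗ x`. -/
def comulHom : Radford k p →ₐ[k] Radford k p ⊗[k] Radford k p :=
  lift (g k p ⊗ₜ g k p) (x k p ⊗ₜ 1 + g k p ⊗ₜ x k p)
    (by rw [Algebra.TensorProduct.tmul_pow, g_pow, Algebra.TensorProduct.one_def])
    (by
      have h := pow_char_add k p (G := g k p ⊗ₜ[k] (1 : Radford k p)) (h := gInv k p ⊗ₜ 1)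
        (X := x k p ⊗ₜ 1) (y := 1 ⊗ₜ x k p)
        (by simp [g_mul_gInv, Algebra.TensorProduct.one_def])
        (by simp [g_pow, Algebra.TensorProduct.one_def])
        (by simp [x_pow])
        (by simp [x_pow])
        (by simp [← TensorProduct.sub_tmul, comm])
        (by simp [commute_iff_eq])
        (by simp [commute_iff_eq])
      simpa using h)
    (by
      have h1 : g k p * x k p = x k p * g k p + (g k p ^ 2 - g k p) := by
        rw [← comm, add_sub_cancel]
      simp only [mul_add, add_mul, Algebra.TensorProduct.tmul_mul_tmul, mul_one, one_mul,
        Algebra.TensorProduct.tmul_pow, h1, TensorProduct.tmul_add, TensorProduct.add_tmul,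
        TensorProduct.tmul_sub, TensorProduct.sub_tmul, ← pow_two]
      abel)

@[simp] lemma comulHom_g : comulHom k p (g k p) = g k p ⊗ₜ g k p := lift_g ..
@[simp] lemma comulHom_x : comulHom k p (x k p) = x k p ⊗ₜ 1 + g k p ⊗ₜ x k p := lift_x ..

instance : Bialgebra k (Radford k p) :=
  Bialgebra.ofAlgHom (comulHom k p) (counitHom k p)
    (algHom_ext (by simp)
      (by simp [TensorProduct.add_tmul, TensorProduct.tmul_add, Algebra.TensorProduct.one_def,
            add_assoc]))
    (algHom_ext (by simp) (by simp))
    (algHom_ext (by simp) (by simp))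

lemma comul_g : Coalgebra.comul (R := k) (g k p) = g k p ⊗ₜ g k p := comulHom_g k p
lemma comul_x : Coalgebra.comul (R := k) (x k p) = x k p ⊗ₜ 1 + g k p ⊗ₜ x k p := comulHom_x k p
lemma counit_g : Coalgebra.counit (R := k) (g k p) = 1 := counitHom_g k p
lemma counit_x : Coalgebra.counit (R := k) (x k p) = 0 := counitHom_x k p

open MulOpposite in
/-- The antipode as an algebra map into the opposite algebra: `g ↦ g⁻¹`, `x ↦ - g⁻¹ x`. -/
def antipodeHom : Radford k p →ₐ[k] (Radford k p)ᵐᵒᵖ :=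
  lift (op (gInv k p)) (op (-(gInv k p * x k p)))
    (by rw [← op_pow, gInv_pow, op_one])
    (by
      have h := pow_char_hX k p (g_mul_gInv k p) (g_pow k p) (x_pow k p) (comm k p)
      nontriviality (Radford k p)
      have : CharP (Radford k p) p :=
        charP_of_injective_algebraMap (algebraMap k (Radford k p)).injective p
      rw [← op_pow, neg_pow, neg_one_pow_char, h, neg_one_mul])
    (by
      rw [← op_mul, ← op_mul, ← op_pow, ← op_sub, ← op_sub, neg_mul, mul_assoc, x_mul_gInv]
      congr 1
      noncomm_ring)

/-- The antipode as a linear map. -/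
def antipodeMap : Radford k p →ₗ[k] Radford k p :=
  (MulOpposite.opLinearEquiv k).symm.toLinearMap ∘ₗ (antipodeHom k p).toLinearMap

lemma antipodeMap_g : antipodeMap k p (g k p) = gInv k p := by
  simp [antipodeMap, antipodeHom]

lemma antipodeMap_x : antipodeMap k p (x k p) = -(gInv k p * x k p) := by
  simp [antipodeMap, antipodeHom]

lemma antipodeMap_algebraMap (r : k) :
    antipodeMap k p (algebraMap k _ r) = algebraMap k _ r := by
  simp [antipodeMap]

lemma antipodeMap_one : antipodeMap k p 1 = 1 := by
  simp [antipodeMap]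

lemma antipodeMap_mul (a b : Radford k p) :
    antipodeMap k p (a * b) = antipodeMap k p b * antipodeMap k p a := by
  simp [antipodeMap]

lemma rTensor_mul (s t : Radford k p ⊗[k] Radford k p) (c : k)
    (hs : LinearMap.mul' k _ ((antipodeMap k p).rTensor _ s) = algebraMap k _ c) :
    LinearMap.mul' k _ ((antipodeMap k p).rTensor _ (s * t)) =
      c • LinearMap.mul' k _ ((antipodeMap k p).rTensor _ t) := by
  induction t with
  | zero => simp
  | add t₁ t₂ h₁ h₂ => simp only [mul_add, map_add, h₁, h₂, smul_add]
  | tmul b b' =>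
    have key : LinearMap.mul' k _ ((antipodeMap k p).rTensor _ (s * (b ⊗ₜ b'))) =
        antipodeMap k p b * LinearMap.mul' k _ ((antipodeMap k p).rTensor _ s) * b' := by
      clear hs
      induction s with
      | zero => simp
      | add s₁ s₂ h₁ h₂ => simp only [add_mul, mul_add, map_add, h₁, h₂]
      | tmul a a' => simp [antipodeMap_mul, mul_assoc]
    rw [key, hs, ← Algebra.commutes, mul_assoc, ← Algebra.smul_def]
    simp

lemma lTensor_mul (s t : Radford k p ⊗[k] Radford k p) (c : k)
    (ht : LinearMap.mul' k _ ((antipodeMap k p).lTensor _ t) = algebraMap k _ c) :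
    LinearMap.mul' k _ ((antipodeMap k p).lTensor _ (s * t)) =
      c • LinearMap.mul' k _ ((antipodeMap k p).lTensor _ s) := by
  induction s with
  | zero => simp
  | add t₁ t₂ h₁ h₂ => simp only [add_mul, map_add, h₁, h₂, smul_add]
  | tmul a a' =>
    have key : LinearMap.mul' k _ ((antipodeMap k p).lTensor _ ((a ⊗ₜ a') * t)) =
        a * LinearMap.mul' k _ ((antipodeMap k p).lTensor _ t) * antipodeMap k p a' := by
      clear ht
      induction t with
      | zero => simp
      | add s₁ s₂ h₁ h₂ => simp only [add_mul, mul_add, map_add, h₁, h₂]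
      | tmul b b' => simp [antipodeMap_mul, mul_assoc]
    rw [key, ht, ← Algebra.commutes, mul_assoc, ← Algebra.smul_def]
    simp

instance : HopfAlgebra k (Radford k p) where
  antipode := antipodeMap k p
  mul_antipode_rTensor_comul := by
    ext a
    simp only [LinearMap.comp_apply, Algebra.linearMap_apply]
    induction a using induct with
    | hk r => simp [Algebra.TensorProduct.algebraMap_apply, antipodeMap_algebraMap]
    | hg => simp [comul_g, counit_g, antipodeMap_g, gInv_mul_g]
    | hx => simp [comul_x, counit_x, antipodeMap_g, antipodeMap_x]
    | hadd a b ha hb => simp only [map_add, ha, hb]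
    | hmul a b ha hb =>
      rw [Bialgebra.comul_mul, rTensor_mul k p _ _ _ ha, hb, Bialgebra.counit_mul, map_mul,
        Algebra.smul_def]
  mul_antipode_lTensor_comul := by
    ext a
    simp only [LinearMap.comp_apply, Algebra.linearMap_apply]
    induction a using induct with
    | hk r => simp [Algebra.TensorProduct.algebraMap_apply, antipodeMap_one]
    | hg => simp [comul_g, counit_g, antipodeMap_g, g_mul_gInv]
    | hx =>
      simp [comul_x, counit_x, antipodeMap_x, antipodeMap_one, ← mul_assoc, g_mul_gInv]
    | hadd a b ha hb => simp only [map_add, ha, hb]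
    | hmul a b ha hb =>
      rw [Bialgebra.comul_mul, lTensor_mul k p _ _ _ hb, ha, Bialgebra.counit_mul, map_mul,
        Algebra.smul_def, Algebra.commutes]

end Hopf
end
end Radford

/-! ### Indicators -/

noncomputable section

open TensorProduct

/-- The Sweedler powers `P_n (h) = h₍₁₎ h₍₂₎ ⋯ h₍ₙ₎` of a Hopf algebra (with `P_0 = u ∘ ε`), by
recursion on `n`: `P_{n+1} = m ∘ (P_n ⊗ id) ∘ Δ`. -/
def sweedlerPower (k : Type u) [Field k] (H : Type v) [Ring H] [HopfAlgebra k H] :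
    ℕ → (H →ₗ[k] H)
  | 0 => Algebra.linearMap k H ∘ₗ Coalgebra.counit
  | n + 1 => LinearMap.mul' k H ∘ₗ (sweedlerPower k H n).rTensor H ∘ₗ Coalgebra.comul

lemma sweedlerPower_one (k : Type u) [Field k] (H : Type v) [Ring H] [HopfAlgebra k H] :
    sweedlerPower k H 1 = LinearMap.id := by
  ext a
  simp [sweedlerPower, LinearMap.rTensor_comp]

/-- The `n`-th indicator `ν_n(H) = Tr (S ∘ P_{n-1})` of a finite-dimensional Hopf algebra, for
`n ≥ 1`. -/
def indicator (k : Type u) [Field k] (H : Type v) [Ring H] [HopfAlgebra k H] (n : ℕ) : k :=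
  LinearMap.trace k H (HopfAlgebra.antipode k ∘ₗ sweedlerPower k H (n - 1))


/-! ### The monoidal category of finite-dimensional representations -/

open CategoryTheory

section Actions

variable {k : Type u} [Field k] {H : Type v} [Ring H] [HopfAlgebra k H]
  {U V W : Type u} [AddCommGroup U] [Module k U] [AddCommGroup V] [Module k V]
  [AddCommGroup W] [Module k W]

/-- `H ⊗ H` acts on `U ⊗ V` factorwise. -/
def actTensor (ρ : H →ₐ[k] Module.End k U) (σ : H →ₐ[k] Module.End k V) :
    H ⊗[k] H →ₐ[k] Module.End k (U ⊗[k] V) :=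
  (Module.endTensorEndAlgHom (R := k) (S := k) (A := k)).comp (Algebra.TensorProduct.map ρ σ)

@[simp] lemma actTensor_tmul (ρ : H →ₐ[k] Module.End k U) (σ : H →ₐ[k] Module.End k V) (a b : H) :
    actTensor ρ σ (a ⊗ₜ b) = TensorProduct.map (ρ a) (σ b) := rfl

/-- The tensor product of two actions: `h` acts on `U ⊗ V` through `Δ(h)`. -/
def tensorAct (ρ : H →ₐ[k] Module.End k U) (σ : H →ₐ[k] Module.End k V) :
    H →ₐ[k] Module.End k (U ⊗[k] V) :=
  (actTensor ρ σ).comp (Bialgebra.comulAlgHom k H)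

variable (k H) in
/-- The trivial action: `h` acts on `k` as multiplication by `ε(h)`. -/
def trivAct : H →ₐ[k] Module.End k k :=
  (Algebra.lmul k k).comp (Bialgebra.counitAlgHom k H)

lemma tensorAct_apply (ρ : H →ₐ[k] Module.End k U) (σ : H →ₐ[k] Module.End k V) (h : H) :
    tensorAct ρ σ h = actTensor ρ σ (Coalgebra.comul h) := rfl

lemma trivAct_apply (h : H) (c : k) :
    trivAct k H h c = Coalgebra.counit (R := k) h * c := rfl

lemma map_equivariant {U' V' : Type u} [AddCommGroup U'] [Module k U'] [AddCommGroup V']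
    [Module k V'] {ρ : H →ₐ[k] Module.End k U} {σ : H →ₐ[k] Module.End k V}
    {ρ' : H →ₐ[k] Module.End k U'} {σ' : H →ₐ[k] Module.End k V'}
    {f : U →ₗ[k] U'} {f' : V →ₗ[k] V'}
    (hf : ∀ h : H, f ∘ₗ ρ h = ρ' h ∘ₗ f) (hf' : ∀ h : H, f' ∘ₗ σ h = σ' h ∘ₗ f') (h : H) :
    TensorProduct.map f f' ∘ₗ tensorAct ρ σ h = tensorAct ρ' σ' h ∘ₗ TensorProduct.map f f' := by
  rw [tensorAct_apply, tensorAct_apply]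
  induction (Coalgebra.comul h : H ⊗[k] H) with
  | zero => simp
  | add a b ha hb => simp only [map_add, LinearMap.comp_add, LinearMap.add_comp, ha, hb]
  | tmul a b => rw [actTensor_tmul, actTensor_tmul, ← TensorProduct.map_comp, hf, hf',
      TensorProduct.map_comp]

lemma assoc_equivariant (ρ : H →ₐ[k] Module.End k U) (σ : H →ₐ[k] Module.End k V)
    (τ : H →ₐ[k] Module.End k W) (h : H) :
    (TensorProduct.assoc k U V W).toLinearMap ∘ₗ tensorAct (tensorAct ρ σ) τ h =
      tensorAct ρ (tensorAct σ τ) h ∘ₗ (TensorProduct.assoc k U V W).toLinearMap := by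
  have h1 : ∀ (t : H ⊗[k] H) (u : U) (v : V) (w : W),
      TensorProduct.assoc k U V W (actTensor (tensorAct ρ σ) τ t ((u ⊗ₜ v) ⊗ₜ w)) =
      (TensorProduct.map (LinearMap.applyₗ u ∘ₗ ρ.toLinearMap)
        (LinearMap.applyₗ (v ⊗ₜ w) ∘ₗ (actTensor σ τ).toLinearMap))
        (TensorProduct.assoc k H H H ((Coalgebra.comul (R := k)).rTensor H t)) := by
    intro t u v w
    induction t with
    | zero => simp
    | add a b ha hb => simp only [map_add, LinearMap.add_apply, ha, hb]
    | tmul a b =>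
      rw [actTensor_tmul, TensorProduct.map_tmul, LinearMap.rTensor_tmul, tensorAct_apply]
      induction (Coalgebra.comul a : H ⊗[k] H) with
      | zero => simp
      | add c d hc hd => simp only [map_add, LinearMap.add_apply, TensorProduct.add_tmul, hc, hd]
      | tmul c d => simp
  have h2 : ∀ (t : H ⊗[k] H) (u : U) (v : V) (w : W),
      actTensor ρ (tensorAct σ τ) t (u ⊗ₜ (v ⊗ₜ w)) =
      (TensorProduct.map (LinearMap.applyₗ u ∘ₗ ρ.toLinearMap)
        (LinearMap.applyₗ (v ⊗ₜ w) ∘ₗ (actTensor σ τ).toLinearMap))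
        ((Coalgebra.comul (R := k)).lTensor H t) := by
    intro t u v w
    induction t with
    | zero => simp
    | add a b ha hb => simp only [map_add, LinearMap.add_apply, ha, hb]
    | tmul a b => rfl
  apply TensorProduct.ext_threefold
  intro u v w
  simp only [LinearMap.comp_apply, LinearEquiv.coe_coe, TensorProduct.assoc_tmul]
  rw [tensorAct_apply, tensorAct_apply, h1, h2, Coalgebra.coassoc_apply]

lemma lid_equivariant (σ : H →ₐ[k] Module.End k V) (h : H) :
    (TensorProduct.lid k V).toLinearMap ∘ₗ tensorAct (trivAct k H) σ h =
      σ h ∘ₗ (TensorProduct.lid k V).toLinearMap := by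
  have h1 : ∀ (t : H ⊗[k] H) (c : k) (v : V),
      TensorProduct.lid k V (actTensor (trivAct k H) σ t (c ⊗ₜ v)) =
      c • σ (TensorProduct.lid k H ((Coalgebra.counit (R := k)).rTensor H t)) v := by
    intro t c v
    induction t with
    | zero => simp
    | add a b ha hb => simp only [map_add, LinearMap.add_apply, smul_add, ha, hb]
    | tmul a b => simp [trivAct_apply, mul_comm, mul_smul]
  apply TensorProduct.ext'
  intro c v
  simp only [LinearMap.comp_apply, LinearEquiv.coe_coe]
  rw [tensorAct_apply, h1, Coalgebra.rTensor_counit_comul]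
  simp

lemma rid_equivariant (σ : H →ₐ[k] Module.End k V) (h : H) :
    (TensorProduct.rid k V).toLinearMap ∘ₗ tensorAct σ (trivAct k H) h =
      σ h ∘ₗ (TensorProduct.rid k V).toLinearMap := by
  have h1 : ∀ (t : H ⊗[k] H) (c : k) (v : V),
      TensorProduct.rid k V (actTensor σ (trivAct k H) t (v ⊗ₜ c)) =
      c • σ (TensorProduct.rid k H ((Coalgebra.counit (R := k)).lTensor H t)) v := by
    intro t c v
    induction t with
    | zero => simp
    | add a b ha hb => simp only [map_add, LinearMap.add_apply, smul_add, ha, hb]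
    | tmul a b => simp [trivAct_apply, mul_comm, mul_smul]
  apply TensorProduct.ext'
  intro v c
  simp only [LinearMap.comp_apply, LinearEquiv.coe_coe]
  rw [tensorAct_apply, h1, Coalgebra.lTensor_counit_comul]
  simp

end Actions

/-- A finite-dimensional representation of the `k`-algebra `H`: a finite-dimensional vector space
`V` with an algebra map `H → End V`. -/
structure FinRep (k : Type u) [Field k] (H : Type v) [Ring H] [Algebra k H] where
  /-- the underlying vector space -/
  V : Type u
  [addCommGroup : AddCommGroup V]
  [module : Module k V]
  [finite : Module.Finite k V]
  /-- the action -/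
  act : H →ₐ[k] Module.End k V

attribute [instance] FinRep.addCommGroup FinRep.module FinRep.finite

namespace FinRep

variable {k : Type u} [Field k] {H : Type v} [Ring H]

section Category

variable [Algebra k H]

/-- Morphisms of representations: `H`-equivariant linear maps. -/
@[ext]
structure Hom (X Y : FinRep k H) where
  /-- the underlying linear map -/
  lin : X.V →ₗ[k] Y.V
  equivariant : ∀ h : H, lin ∘ₗ X.act h = Y.act h ∘ₗ lin

instance : Category (FinRep k H) where
  Hom := Hom
  id X := ⟨LinearMap.id, fun _ => rfl⟩
  comp f g := ⟨g.lin ∘ₗ f.lin, fun h => by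
    rw [LinearMap.comp_assoc, f.equivariant, ← LinearMap.comp_assoc, g.equivariant,
      LinearMap.comp_assoc]⟩

@[ext] lemma hom_ext {X Y : FinRep k H} {f g : X ⟶ Y} (h : f.lin = g.lin) : f = g := Hom.ext h

@[simp] lemma id_lin (X : FinRep k H) : Hom.lin (𝟙 X) = LinearMap.id := rfl
@[simp] lemma comp_lin {X Y Z : FinRep k H} (f : X ⟶ Y) (g : Y ⟶ Z) :
    (f ≫ g).lin = g.lin ∘ₗ f.lin := rfl

lemma equivariant_apply {X Y : FinRep k H} (f : X ⟶ Y) (h : H) (v : X.V) :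
    f.lin (X.act h v) = Y.act h (f.lin v) := LinearMap.congr_fun (f.equivariant h) v

instance (X Y : FinRep k H) : Zero (X ⟶ Y) := ⟨⟨0, fun h => by simp⟩⟩
instance (X Y : FinRep k H) : Add (X ⟶ Y) := ⟨fun f g => ⟨f.lin + g.lin, fun h => by
  rw [LinearMap.add_comp, LinearMap.comp_add, f.equivariant, g.equivariant]⟩⟩
instance (X Y : FinRep k H) : Neg (X ⟶ Y) := ⟨fun f => ⟨-f.lin, fun h => by
  rw [LinearMap.neg_comp, LinearMap.comp_neg, f.equivariant]⟩⟩
instance (X Y : FinRep k H) : SMul k (X ⟶ Y) := ⟨fun c f => ⟨c • f.lin, fun h => by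
  rw [LinearMap.smul_comp, LinearMap.comp_smul, f.equivariant]⟩⟩

@[simp] lemma zero_lin (X Y : FinRep k H) : Hom.lin (0 : X ⟶ Y) = 0 := rfl
@[simp] lemma add_lin {X Y : FinRep k H} (f g : X ⟶ Y) : (f + g).lin = f.lin + g.lin := rfl
@[simp] lemma neg_lin {X Y : FinRep k H} (f : X ⟶ Y) : (-f).lin = -f.lin := rfl
@[simp] lemma smul_lin {X Y : FinRep k H} (c : k) (f : X ⟶ Y) : (c • f).lin = c • f.lin := rfl

instance : Preadditive (FinRep k H) where
  homGroup X Y :=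
    { add_assoc := fun a b c => by ext1; simp [add_assoc]
      zero_add := fun a => by ext1; simp
      add_zero := fun a => by ext1; simp
      add_comm := fun a b => by ext1; simp [add_comm]
      neg_add_cancel := fun a => by ext1; simp
      nsmul := nsmulRec
      zsmul := zsmulRec }
  add_comp X Y Z f g h := by ext1; exact LinearMap.comp_add _ _ _
  comp_add X Y Z f g h := by ext1; exact LinearMap.add_comp _ _ _

instance : Linear k (FinRep k H) where
  homModule X Y :=
    { one_smul := fun a => by ext1; simp
      mul_smul := fun a b c => by ext1; simp [mul_smul]
      smul_zero := fun a => by ext1; exact smul_zero a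
      smul_add := fun a b c => by ext1; exact smul_add a b.lin c.lin
      add_smul := fun a b c => by ext1; exact add_smul a b c.lin
      zero_smul := fun a => by ext1; exact zero_smul k a.lin }
  smul_comp X Y Z r f g := by ext1; exact LinearMap.comp_smul _ _ _
  comp_smul X Y Z f r g := by ext1; exact LinearMap.smul_comp _ _ _

/-- An equivariant linear isomorphism is an isomorphism of representations. -/
def mkIso {X Y : FinRep k H} (e : X.V ≃ₗ[k] Y.V)
    (he : ∀ h : H, e.toLinearMap ∘ₗ X.act h = Y.act h ∘ₗ e.toLinearMap) : X ≅ Y where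
  hom := ⟨e.toLinearMap, he⟩
  inv := ⟨e.symm.toLinearMap, fun h => by
    ext v
    apply e.injective
    simpa using (LinearMap.congr_fun (he h) (e.symm v)).symm⟩
  hom_inv_id := by ext v; exact e.symm_apply_apply v
  inv_hom_id := by ext v; exact e.apply_symm_apply v

/-- The underlying vector space functor. -/
def forgetToModule : FinRep k H ⥤ ModuleCat.{u} k where
  obj X := ModuleCat.of k X.V
  map f := ModuleCat.ofHom f.lin
  map_id _ := rfl
  map_comp _ _ := rfl

instance : (forgetToModule (k := k) (H := H)).Faithful where
  map_injective h := Hom.ext (congrArg ModuleCat.Hom.hom h)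

end Category

section Monoidal

variable [HopfAlgebra k H]

instance : MonoidalCategoryStruct (FinRep k H) where
  tensorObj X Y := { V := X.V ⊗[k] Y.V, act := tensorAct X.act Y.act }
  tensorUnit := { V := k, act := trivAct k H }
  tensorHom f g := ⟨TensorProduct.map f.lin g.lin, map_equivariant f.equivariant g.equivariant⟩
  whiskerLeft X _ _ f :=
    ⟨TensorProduct.map LinearMap.id f.lin, map_equivariant (fun _ => rfl) f.equivariant⟩
  whiskerRight f Y :=
    ⟨TensorProduct.map f.lin LinearMap.id, map_equivariant f.equivariant (fun _ => rfl)⟩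
  associator X Y Z :=
    mkIso (TensorProduct.assoc k X.V Y.V Z.V) (assoc_equivariant X.act Y.act Z.act)
  leftUnitor X := mkIso (TensorProduct.lid k X.V) (lid_equivariant X.act)
  rightUnitor X := mkIso (TensorProduct.rid k X.V) (rid_equivariant X.act)

/-- `Rep(H)` is a monoidal category, with the structure morphisms of vector spaces. -/
instance : MonoidalCategory (FinRep k H) :=
  Monoidal.induced forgetToModule
    { μIso := fun _ _ => Iso.refl _
      εIso := Iso.refl _
      whiskerLeft_eq := fun _ _ _ f => by
        ext1; apply TensorProduct.ext'; intro a b; rfl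
      whiskerRight_eq := fun f _ => by
        ext1; apply TensorProduct.ext'; intro a b; rfl
      tensorHom_eq := fun f g => by
        ext1; apply TensorProduct.ext'; intro a b; rfl
      associator_eq := fun _ _ _ => by
        ext1; apply TensorProduct.ext_threefold; intro a b c; rfl
      leftUnitor_eq := fun _ => by
        ext1; apply TensorProduct.ext'; intro a b; rfl
      rightUnitor_eq := fun _ => by
        ext1; apply TensorProduct.ext'; intro a b; rfl }

end Monoidal

end FinRep

/-- Two Hopf algebras over `k` are gauge equivalent if their categories of finite-dimensional
representations are equivalent as `k`-linear monoidal categories. -/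
def GaugeEquivalent (k : Type u) [Field k] (H : Type v) [Ring H] [HopfAlgebra k H]
    (K : Type w) [Ring K] [HopfAlgebra k K] : Prop :=
  ∃ E : FinRep k H ≌ FinRep k K,
    E.functor.Additive ∧ E.functor.Linear k ∧ Nonempty E.functor.Monoidal

end

end RadfordIndicator

/-! Only the algebra structure matters: every Hopf algebra `K` isomorphic to `R(p)` as an algebra
has the stated indicators, whatever its coproduct (`AlgebraIso.indicator_eq`). The identity of
`R(p)` gives the formula, and gauge invariance reduces to producing an algebra isomorphism `R(p) ≃
K`; no general invariance theorem for indicators is used.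

The isomorphism comes from `FinRep.exists_algEquiv`. One-dimensional representations are the ones
with a tensor inverse, so a monoidal equivalence respects them. Every nonzero representation of
`R(p)` has a one-dimensional quotient, and this property passes to `K`. The image of the regular
representation maps onto each character in at most one way up to scalars, hence is cyclic. Comparing
dimensions in both directions identifies it with the regular representation of `K`, and endomorphism
algebras then agree.

To compute, pass to `K*`, where antipode and Sweedler powers are transposes, so the indicators are
the same (`ConvDual.indicator_eq`). The characters of `R(p)` are `g ↦ 1`, `x ↦ i` with `i ^ p = i`.
The counit of `K` is one of them, and its non-split extension by the character with `i` lowered by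
one supplies a group-like `γ` and a skew-primitive `ξ` in `K*`. Skew-derivations are determined by
their values on `g` and `x`; comparing these gives `γ ^ p = 1` and `[γ, ξ] = c (γ² - γ)`. No formula
for `ξ ^ p` is needed.

Filter `K*` by degree in `ξ`. The associated graded algebra is commutative, so `S ∘ P_m` is
multiplicative on it and sends `γ^a ξ^j` to `γ^(-ma) M^j ξ^j` plus lower terms, with `M = -(γ⁻¹ + ⋯
+ γ⁻ᵐ)`. The `p²` monomials with `a, j < p` form a basis. On the diagonal, a term `γ^n` of `M^j`
counts the solutions `a` mod `p` of `(m + 1) a = n`: one if `p ∤ m + 1`, otherwise none or `p`,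
which is zero in `k`. In the first case the trace is `∑_{j<p} ε(M)^j = ∑_{j<p} (-m)^j = ((-m)^p - 1)
/ (-m - 1) = 1` by Fermat. Take `m = n - 1`. -/

namespace RadfordIndicator

/-! ### The dual of a finite-dimensional Hopf algebra -/

noncomputable section

open Coalgebra

/-- The dual space of a Hopf algebra, with the convolution product. -/
def ConvDual (k : Type u) [Field k] (H : Type v) [Ring H] [HopfAlgebra k H] : Type (max u v) :=
  WithConv (H →ₗ[k] k)

namespace ConvDual

variable {k : Type u} [Field k] {H : Type v} [Ring H] [HopfAlgebra k H]

instance : Ring (ConvDual k H) := inferInstanceAs (Ring (WithConv (H →ₗ[k] k)))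

instance : Algebra k (ConvDual k H) := inferInstanceAs (Algebra k (WithConv (H →ₗ[k] k)))

variable (k H) in
/-- The elements of the dual as functionals. -/
def ev : ConvDual k H ≃ₗ[k] (H →ₗ[k] k) where
  toFun f := WithConv.ofConv f
  invFun f := WithConv.toConv f
  map_add' _ _ := rfl
  map_smul' _ _ := rfl
  left_inv _ := rfl
  right_inv _ := rfl

lemma ext_ev {f g : ConvDual k H} (h : ∀ a, ev k H f a = ev k H g a) : f = g :=
  (ev k H).injective (LinearMap.ext h)

lemma ev_mul_repr (f g : ConvDual k H) (a : H) : ev k H (f * g) a =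
    ∑ i ∈ (ℛ k a).index, ev k H f ((ℛ k a).left i) * ev k H g ((ℛ k a).right i) :=
  (ℛ k a).convMul_apply f g

lemma ev_mul (f g : ConvDual k H) (a : H) : ev k H (f * g) a =
    LinearMap.mul' k k (TensorProduct.map (ev k H f) (ev k H g) (comul a)) := rfl

@[simp] lemma ev_one (a : H) : ev k H 1 a = counit (R := k) a := rfl

variable [Module.Finite k H]

instance : Module.Finite k (ConvDual k H) := Module.Finite.equiv (ev k H).symm

variable (k H) in
/-- `H* ⊗ X` as a space of linear maps. -/
def tensorEquiv (X : Type w) [AddCommGroup X] [Module k X] :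
    ConvDual k H ⊗[k] X ≃ₗ[k] (H →ₗ[k] X) :=
  (TensorProduct.congr (ev k H) (LinearEquiv.refl k X)).trans (dualTensorHomEquiv k H X)

@[simp] lemma tensorEquiv_tmul {X : Type w} [AddCommGroup X] [Module k X] (f : ConvDual k H) (x : X)
    (a : H) : tensorEquiv k H X (f ⊗ₜ x) a = ev k H f a • x := by
  simp [tensorEquiv]

lemma tensor_ext {X : Type w} [AddCommGroup X] [Module k X] {s t : ConvDual k H ⊗[k] X}
    (h : ∀ a, tensorEquiv k H X s a = tensorEquiv k H X t a) : s = t :=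
  (tensorEquiv k H X).injective (LinearMap.ext h)

variable (k H) in
/-- The pairing of `H* ⊗ H*` with `H ⊗ H`. -/
def pair (a b : H) : ConvDual k H ⊗[k] ConvDual k H →ₗ[k] k :=
  LinearMap.applyₗ b ∘ₗ (ev k H).toLinearMap ∘ₗ LinearMap.applyₗ a ∘ₗ
    (tensorEquiv k H (ConvDual k H)).toLinearMap

@[simp] lemma pair_tmul (f g : ConvDual k H) (a b : H) :
    pair k H a b (f ⊗ₜ g) = ev k H f a * ev k H g b := by
  simp [pair]

/-- By finite dimension `H* ⊗ H*` is the space of bilinear forms on `H`. Testing on pairs turns the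
coalgebra axioms of the dual into algebra axioms of `H`. -/
lemma pair_ext {s t : ConvDual k H ⊗[k] ConvDual k H}
    (h : ∀ a b, pair k H a b s = pair k H a b t) : s = t :=
  tensor_ext fun a => ext_ev (h a)

/-- The coproduct of the dual: `⟨Δ f, a ⊗ b⟩ = f (a b)`. -/
def comulMap : ConvDual k H →ₗ[k] ConvDual k H ⊗[k] ConvDual k H where
  toFun f := (tensorEquiv k H (ConvDual k H)).symm
    ((ev k H).symm.toLinearMap ∘ₗ (LinearMap.mul k H).compr₂ (ev k H f))
  map_add' f g := by
    rw [← map_add]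
    congr 1
  map_smul' c f := by
    rw [← map_smul]
    congr 1

instance : CoalgebraStruct k (ConvDual k H) where
  comul := comulMap
  counit := LinearMap.applyₗ 1 ∘ₗ (ev k H).toLinearMap

lemma counit_eq (f : ConvDual k H) : counit (R := k) f = ev k H f 1 := rfl

@[simp] lemma pair_comul (f : ConvDual k H) (a b : H) :
    pair k H a b (comul (R := k) f) = ev k H f (a * b) := by
  change pair k H a b (comulMap f) = _
  simp [comulMap, pair]

instance : Coalgebra k (ConvDual k H) where
  coassoc := by
    ext f : 1
    apply tensor_ext
    intro a
    apply pair_ext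
    intro b c
    simp only [LinearMap.comp_apply, LinearEquiv.coe_coe]
    -- Applying the coproduct to one tensor factor becomes multiplying two arguments of the pairing
    -- (here the first two, in `h2` the last two), so coassociativity is associativity of `H`.
    have h1 : ∀ s : ConvDual k H ⊗[k] ConvDual k H,
        pair k H b c (tensorEquiv k H _ (TensorProduct.assoc k _ _ _
          (comul.rTensor _ s)) a) = pair k H (a * b) c s := by
      intro s
      induction s with
      | zero => simp
      | add s t hs ht => simp only [map_add, LinearMap.add_apply, hs, ht]
      | tmul f g =>
        have h0 : ∀ t : ConvDual k H ⊗[k] ConvDual k H,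
            pair k H b c (tensorEquiv k H _ (TensorProduct.assoc k _ _ _
              (t ⊗ₜ g)) a) = pair k H a b t * ev k H g c := by
          intro t
          induction t with
          | zero => simp
          | add s t hs ht =>
            simp only [map_add, TensorProduct.add_tmul, LinearMap.add_apply, hs, ht, add_mul]
          | tmul f f' => simp [mul_assoc]
        rw [LinearMap.rTensor_tmul, h0, pair_comul, pair_tmul]
    have h2 : ∀ s : ConvDual k H ⊗[k] ConvDual k H,
        pair k H b c (tensorEquiv k H _ (comul.lTensor _ s) a) = pair k H a (b * c) s := by
      intro s
      induction s with
      | zero => simp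
      | add s t hs ht => simp only [map_add, LinearMap.add_apply, hs, ht]
      | tmul f g => simp
    rw [h1, h2]
    simp [mul_assoc]
  rTensor_counit_comp_comul := by
    ext f : 1
    apply (TensorProduct.lid k (ConvDual k H)).injective
    apply ext_ev
    intro a
    have h : ∀ s : ConvDual k H ⊗[k] ConvDual k H,
        ev k H (TensorProduct.lid k _ (counit.rTensor _ s)) a = pair k H 1 a s := by
      intro s
      induction s with
      | zero => simp
      | add s t hs ht => simp only [map_add, LinearMap.add_apply, hs, ht]
      | tmul f g => simp [counit_eq]
    rw [LinearMap.comp_apply, h]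
    simp
  lTensor_counit_comp_comul := by
    ext f : 1
    apply (TensorProduct.rid k (ConvDual k H)).injective
    apply ext_ev
    intro a
    have h : ∀ s : ConvDual k H ⊗[k] ConvDual k H,
        ev k H (TensorProduct.rid k _ (counit.lTensor _ s)) a = pair k H a 1 s := by
      intro s
      induction s with
      | zero => simp
      | add s t hs ht => simp only [map_add, LinearMap.add_apply, hs, ht]
      | tmul f g => simp [counit_eq, mul_comm]
    rw [LinearMap.comp_apply, h]
    simp

lemma pair_mul (s t : ConvDual k H ⊗[k] ConvDual k H) (a b : H) :
    pair k H a b (s * t) = ∑ i ∈ (ℛ k a).index, ∑ j ∈ (ℛ k b).index,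
      pair k H ((ℛ k a).left i) ((ℛ k b).left j) s *
      pair k H ((ℛ k a).right i) ((ℛ k b).right j) t := by
  induction s with
  | zero => simp
  | add s s' hs hs' => simp only [map_add, add_mul, hs, hs', Finset.sum_add_distrib]
  | tmul f g =>
    induction t with
    | zero => simp
    | add s s' hs hs' => simp only [map_add, mul_add, hs, hs', Finset.sum_add_distrib]
    | tmul f' g' =>
      simp only [Algebra.TensorProduct.tmul_mul_tmul, pair_tmul, ev_mul_repr, Finset.sum_mul_sum]
      refine Finset.sum_congr rfl fun i _ => Finset.sum_congr rfl fun j _ => ?_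
      ring

-- This is `Δ(ab) = Δ(a) Δ(b)` in `H`; through the pairing it becomes multiplicativity of the
-- coproduct of the dual.
omit [Module.Finite k H] in
lemma ev_mul_mul (f g : ConvDual k H) (a b : H) :
    ev k H (f * g) (a * b) = ∑ i ∈ (ℛ k a).index, ∑ j ∈ (ℛ k b).index,
      ev k H f ((ℛ k a).left i * (ℛ k b).left j) *
      ev k H g ((ℛ k a).right i * (ℛ k b).right j) := by
  rw [ev_mul, Bialgebra.comul_mul, ← (ℛ k a).eq, ← (ℛ k b).eq, Finset.sum_mul_sum]
  simp

instance : Bialgebra k (ConvDual k H) :=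
  Bialgebra.mk' k (ConvDual k H)
    (by simp [counit_eq])
    (by intro f g; simp [counit_eq, ev_mul, Algebra.TensorProduct.one_def])
    (by
      apply pair_ext
      intro a b
      rw [pair_comul]
      simp [Algebra.TensorProduct.one_def])
    (by
      intro f g
      apply pair_ext
      intro a b
      rw [pair_comul, pair_mul]
      simp only [pair_comul]
      exact ev_mul_mul f g a b)

omit [Module.Finite k H] in
variable (k H) in
/-- The transpose of a linear endomorphism. -/
def transpose (T : H →ₗ[k] H) : ConvDual k H →ₗ[k] ConvDual k H :=
  (ev k H).symm.toLinearMap ∘ₗ Module.Dual.transpose (R := k) T ∘ₗ (ev k H).toLinearMap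

omit [Module.Finite k H] in
@[simp] lemma ev_transpose (T : H →ₗ[k] H) (f : ConvDual k H) (a : H) :
    ev k H (transpose k H T f) a = ev k H f (T a) := by
  simp [transpose, Module.Dual.transpose_apply]

lemma trace_transpose (T : H →ₗ[k] H) :
    LinearMap.trace k (ConvDual k H) (transpose k H T) = LinearMap.trace k H T := by
  rw [← LinearMap.trace_transpose' T]
  exact LinearMap.trace_conj' (Module.Dual.transpose (R := k) T)
    ((ev k H).symm : Module.Dual k H ≃ₗ[k] ConvDual k H)

/-- With the antipode for `T` this yields an antipode axiom of the dual; with a Sweedler power it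
yields the recursion step of `sweedlerPower_eq`. -/
lemma mul'_rTensor_transpose (T : H →ₗ[k] H) (s : ConvDual k H ⊗[k] ConvDual k H) (a : H) :
    ev k H (LinearMap.mul' k _ ((transpose k H T).rTensor _ s)) a =
      ∑ i ∈ (ℛ k a).index, pair k H (T ((ℛ k a).left i)) ((ℛ k a).right i) s := by
  induction s with
  | zero => simp
  | add s s' hs hs' =>
    simp only [map_add, LinearMap.add_apply, hs, hs', Finset.sum_add_distrib]
  | tmul f g => simp [ev_mul_repr]

lemma mul'_lTensor_transpose (T : H →ₗ[k] H) (s : ConvDual k H ⊗[k] ConvDual k H) (a : H) :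
    ev k H (LinearMap.mul' k _ ((transpose k H T).lTensor _ s)) a =
      ∑ i ∈ (ℛ k a).index, pair k H ((ℛ k a).left i) (T ((ℛ k a).right i)) s := by
  induction s with
  | zero => simp
  | add s s' hs hs' =>
    simp only [map_add, LinearMap.add_apply, hs, hs', Finset.sum_add_distrib]
  | tmul f g => simp [ev_mul_repr]

instance : HopfAlgebra k (ConvDual k H) where
  antipode := transpose k H (HopfAlgebra.antipode k)
  mul_antipode_rTensor_comul := by
    ext f : 1
    apply ext_ev
    intro a
    refine (mul'_rTensor_transpose _ _ a).trans ?_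
    simp only [pair_comul]
    rw [← map_sum, HopfAlgebra.sum_antipode_mul_eq_smul, map_smul]
    simp [Algebra.algebraMap_eq_smul_one, counit_eq, mul_comm]
  mul_antipode_lTensor_comul := by
    ext f : 1
    apply ext_ev
    intro a
    refine (mul'_lTensor_transpose _ _ a).trans ?_
    simp only [pair_comul]
    rw [← map_sum, HopfAlgebra.sum_mul_antipode_eq_smul, map_smul]
    simp [Algebra.algebraMap_eq_smul_one, counit_eq, mul_comm]

lemma antipode_eq : HopfAlgebra.antipode k (A := ConvDual k H) =
    transpose k H (HopfAlgebra.antipode k) := rfl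

lemma sweedlerPower_eq (n : ℕ) :
    sweedlerPower k (ConvDual k H) n = transpose k H (sweedlerPower k H n) := by
  induction n with
  | zero =>
    ext f : 1
    apply ext_ev
    intro a
    simp [sweedlerPower, counit_eq, Algebra.algebraMap_eq_smul_one, mul_comm]
  | succ n ih =>
    ext f : 1
    apply ext_ev
    intro a
    rw [sweedlerPower, ih]
    refine (mul'_rTensor_transpose _ _ a).trans ?_
    simp only [pair_comul, ev_transpose]
    rw [← map_sum, sweedlerPower, LinearMap.comp_apply, LinearMap.comp_apply]
    conv_rhs => rw [← (ℛ k a).eq]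
    simp

/-- Transposition reverses the order of `S` and `P_{n-1}`; cyclicity of the trace restores it. -/
theorem indicator_eq (n : ℕ) : indicator k (ConvDual k H) n = indicator k H n := by
  have h : transpose k H (HopfAlgebra.antipode k) ∘ₗ transpose k H (sweedlerPower k H (n - 1)) =
      transpose k H (sweedlerPower k H (n - 1) ∘ₗ HopfAlgebra.antipode k) := by
    ext f : 1
    apply ext_ev
    intro a
    simp
  rw [indicator, antipode_eq, sweedlerPower_eq, h, trace_transpose, LinearMap.trace_comp_comm',
    indicator]

end ConvDual

end

end RadfordIndicator

namespace RadfordIndicator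

/-! ### Hopf algebras generated by a group-like and a skew-primitive element -/

noncomputable section

open Coalgebra

/-- A group-like element `γ` of order dividing `p` and a `(1, γ)`-skew-primitive element `ξ` with
`[γ, ξ] = c (γ ^ 2 - γ)`. -/
structure IsRadfordPair (k : Type u) [Field k] {B : Type v} [Ring B] [HopfAlgebra k B] (p : ℕ)
    (c : k) (γ ξ : B) : Prop where
  comul_left : comul (R := k) γ = γ ⊗ₜ γ
  comul_right : comul (R := k) ξ = ξ ⊗ₜ 1 + γ ⊗ₜ ξ
  counit_left : counit (R := k) γ = 1
  counit_right : counit (R := k) ξ = 0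
  pow_eq : γ ^ p = 1
  comm : γ * ξ - ξ * γ = c • (γ ^ 2 - γ)

/-- The span of the monomials `γ ^ a * ξ ^ j` with `j < r`. -/
def degLT (k : Type u) [Field k] {B : Type v} [Ring B] [Algebra k B] (γ ξ : B) (r : ℕ) :
    Submodule k B :=
  Submodule.span k {b | ∃ a j : ℕ, j < r ∧ b = γ ^ a * ξ ^ j}

namespace degLT

variable {k : Type u} [Field k] {B : Type v} [Ring B] [Algebra k B] {γ ξ : B}

lemma mono {r s : ℕ} (h : r ≤ s) : degLT k γ ξ r ≤ degLT k γ ξ s := by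
  apply Submodule.span_mono
  rintro _ ⟨a, j, hj, rfl⟩
  exact ⟨a, j, hj.trans_le h, rfl⟩

/-- The degree bound is strict: degree zero is `degLT k γ ξ 1`, and a congruence modulo `degLT k γ ξ
0` is an equality. Inductions on the degree start from this. -/
lemma zero_eq : degLT k γ ξ 0 = ⊥ := by
  simp [degLT]

lemma monomial_mem (a : ℕ) {j r : ℕ} (h : j < r) : γ ^ a * ξ ^ j ∈ degLT k γ ξ r :=
  Submodule.subset_span ⟨a, j, h, rfl⟩

lemma pow_mem (a : ℕ) : γ ^ a ∈ degLT k γ ξ 1 := by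
  simpa using monomial_mem (k := k) (γ := γ) (ξ := ξ) a one_pos

lemma one_mem : (1 : B) ∈ degLT k γ ξ 1 := by
  simpa using pow_mem (k := k) (γ := γ) (ξ := ξ) 0

lemma left_mem : γ ∈ degLT k γ ξ 1 := by
  simpa using pow_mem (k := k) (γ := γ) (ξ := ξ) 1

lemma right_mem : ξ ∈ degLT k γ ξ 2 := by
  simpa using monomial_mem (k := k) (γ := γ) (ξ := ξ) 0 one_lt_two

lemma mem_of_le {r s : ℕ} {u : B} (hu : u ∈ degLT k γ ξ r) (h : r ≤ s) : u ∈ degLT k γ ξ s :=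
  mono h hu

lemma induct {r : ℕ} {P : ∀ u : B, u ∈ degLT k γ ξ r → Prop} (h0 : P 0 (zero_mem _))
    (hadd : ∀ a b ha hb, P a ha → P b hb → P (a + b) (add_mem ha hb))
    (hsmul : ∀ (x : k) (a : B) (ha), P a ha → P (x • a) (Submodule.smul_mem _ x ha))
    (hm : ∀ (a j : ℕ) (hj : j < r), P (γ ^ a * ξ ^ j) (monomial_mem a hj))
    {u : B} (hu : u ∈ degLT k γ ξ r) : P u hu := by
  induction hu using Submodule.span_induction with
  | mem x hx => obtain ⟨a, j, hj, rfl⟩ := hx; exact hm a j hj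
  | zero => exact h0
  | add x y hx' hy' hx hy => exact hadd x y hx' hy' hx hy
  | smul a x hx' hx => exact hsmul a x hx' hx

lemma pow_left_mul_mem (a : ℕ) {r : ℕ} {u : B} (hu : u ∈ degLT k γ ξ r) :
    γ ^ a * u ∈ degLT k γ ξ r := by
  induction hu using induct with
  | h0 => simp
  | hadd x y _ _ hx hy => rw [mul_add]; exact add_mem hx hy
  | hsmul c x _ hx => rw [mul_smul_comm]; exact Submodule.smul_mem _ _ hx
  | hm b j hj => rw [← mul_assoc, ← pow_add]; exact monomial_mem _ hj

lemma mul_pow_right_mem (i : ℕ) {r : ℕ} {u : B} (hu : u ∈ degLT k γ ξ r) :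
    u * ξ ^ i ∈ degLT k γ ξ (r + i) := by
  induction hu using induct with
  | h0 => simp
  | hadd x y _ _ hx hy => rw [add_mul]; exact add_mem hx hy
  | hsmul c x _ hx => rw [smul_mul_assoc]; exact Submodule.smul_mem _ _ hx
  | hm b j hj => rw [mul_assoc, ← pow_add]; exact monomial_mem _ (by omega)

variable {c : k} (hc : γ * ξ - ξ * γ = c • (γ ^ 2 - γ))

include hc

lemma commutator_mem : γ * ξ - ξ * γ ∈ degLT k γ ξ 1 := by
  rw [hc]
  exact Submodule.smul_mem _ _ (sub_mem (pow_mem 2) left_mem)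

/-- `[γ, ξ]` is a polynomial in `γ`, so moving `ξ` past a power of `γ` costs only terms of degree
zero. -/
lemma right_commutator_pow_mem (a : ℕ) : ξ * γ ^ a - γ ^ a * ξ ∈ degLT k γ ξ 1 := by
  induction a with
  | zero => simp
  | succ a ih =>
    have h1 : (ξ * γ ^ a - γ ^ a * ξ) * γ ∈ degLT k γ ξ 1 := by
      have h : ∀ u ∈ degLT k γ ξ 1, u * γ ∈ degLT k γ ξ 1 := by
        intro u hu
        induction hu using induct with
        | h0 => simp
        | hadd x y _ _ hx hy => rw [add_mul]; exact add_mem hx hy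
        | hsmul c x _ hx => rw [smul_mul_assoc]; exact Submodule.smul_mem _ _ hx
        | hm b j hj =>
          obtain rfl : j = 0 := by omega
          rw [pow_zero, mul_one, ← pow_succ]
          exact pow_mem _
      exact h _ ih
    have h2 := pow_left_mul_mem a (neg_mem (commutator_mem hc))
    convert add_mem h1 h2 using 1
    rw [pow_succ]
    noncomm_ring

lemma right_mul_mem {r : ℕ} {u : B} (hu : u ∈ degLT k γ ξ r) : ξ * u ∈ degLT k γ ξ (r + 1) := by
  induction hu using induct with
  | h0 => simp
  | hadd x y _ _ hx hy => rw [mul_add]; exact add_mem hx hy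
  | hsmul c x _ hx => rw [mul_smul_comm]; exact Submodule.smul_mem _ _ hx
  | hm b j hj =>
    have h1 := mul_pow_right_mem j (right_commutator_pow_mem hc b)
    have h2 : γ ^ b * ξ ^ (j + 1) ∈ degLT k γ ξ (r + 1) := monomial_mem b (by omega)
    convert add_mem (mem_of_le h1 (by omega : 1 + j ≤ r + 1)) h2 using 1
    rw [pow_succ']
    noncomm_ring

lemma mul_mem {i r : ℕ} {u w : B} (hu : u ∈ degLT k γ ξ (i + 1)) (hw : w ∈ degLT k γ ξ r) :
    u * w ∈ degLT k γ ξ (i + r) := by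
  induction hu using induct with
  | h0 => simp
  | hadd x y _ _ hx hy => rw [add_mul]; exact add_mem hx hy
  | hsmul c x _ hx => rw [smul_mul_assoc]; exact Submodule.smul_mem _ _ hx
  | hm b j hj =>
    have h : ξ ^ j * w ∈ degLT k γ ξ (r + j) := by
      clear hj
      induction j with
      | zero => simpa
      | succ j ih => rw [pow_succ', mul_assoc]; exact right_mul_mem hc ih
    rw [mul_assoc]
    exact pow_left_mul_mem b (mem_of_le h (by omega))

lemma mul_mem' {j r : ℕ} {u w : B} (hu : u ∈ degLT k γ ξ r) (hw : w ∈ degLT k γ ξ (j + 1)) :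
    u * w ∈ degLT k γ ξ (r + j) := by
  cases r with
  | zero =>
    rw [zero_eq, Submodule.mem_bot] at hu
    simp [hu]
  | succ i => exact mem_of_le (mul_mem hc hu hw) (by omega)

lemma pow_mem_one {u : B} (hu : u ∈ degLT k γ ξ 1) (n : ℕ) : u ^ n ∈ degLT k γ ξ 1 := by
  induction n with
  | zero => simpa using one_mem
  | succ n ih => rw [pow_succ]; exact mem_of_le (mul_mem (i := 0) hc ih hu) (by omega)

/-- Commuting `γ` past one factor `ξ` replaces that factor by a polynomial in `γ`, so `ad γ` lowers
the degree. -/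
lemma left_commutator_mem {j : ℕ} {w : B} (hw : w ∈ degLT k γ ξ (j + 1)) :
    γ * w - w * γ ∈ degLT k γ ξ j := by
  have h : ∀ j : ℕ, γ * ξ ^ j - ξ ^ j * γ ∈ degLT k γ ξ j := by
    intro j
    induction j with
    | zero => simp
    | succ j ih =>
      have h1 := mul_pow_right_mem j (commutator_mem hc)
      have h2 := right_mul_mem hc ih
      convert add_mem (mem_of_le h1 (by omega : 1 + j ≤ j + 1)) h2 using 1
      rw [pow_succ']
      noncomm_ring
  induction hw using induct with
  | h0 => simp
  | hadd x y _ _ hx hy =>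
    convert add_mem hx hy using 1
    noncomm_ring
  | hsmul c x _ hx =>
    convert Submodule.smul_mem _ c hx using 1
    rw [mul_smul_comm, smul_mul_assoc, smul_sub]
  | hm b i hi =>
    convert pow_left_mul_mem b (mem_of_le (h i) (by omega : i ≤ j)) using 1
    rw [mul_sub, ← mul_assoc, ← mul_assoc, ← mul_assoc, ← pow_succ, ← pow_succ']

/-- `ξ` commutes with its own powers and with powers of `γ` up to degree zero, so `ad ξ` does not
raise the degree. -/
lemma right_commutator_mem {j : ℕ} {w : B} (hw : w ∈ degLT k γ ξ j) :
    ξ * w - w * ξ ∈ degLT k γ ξ j := by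
  induction hw using induct with
  | h0 => simp
  | hadd x y _ _ hx hy =>
    convert add_mem hx hy using 1
    noncomm_ring
  | hsmul c x _ hx =>
    convert Submodule.smul_mem _ c hx using 1
    rw [mul_smul_comm, smul_mul_assoc, smul_sub]
  | hm b i hi =>
    have h1 := mul_pow_right_mem i (right_commutator_pow_mem hc b)
    convert mem_of_le h1 (by omega : 1 + i ≤ j) using 1
    rw [mul_assoc _ (ξ ^ i) ξ, ← pow_succ, pow_succ']
    noncomm_ring

/-- The associated graded algebra is commutative. -/
lemma mul_sub_mul_mem {i j : ℕ} {u w : B} (hu : u ∈ degLT k γ ξ (i + 1))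
    (hw : w ∈ degLT k γ ξ (j + 1)) : u * w - w * u ∈ degLT k γ ξ (i + j) := by
  have hγ : ∀ a : ℕ, γ ^ a * w - w * γ ^ a ∈ degLT k γ ξ j := by
    intro a
    induction a with
    | zero => simp
    | succ a ih =>
      convert add_mem (pow_left_mul_mem a (left_commutator_mem hc hw))
        (mul_mem' (j := 0) hc ih left_mem) using 1
      rw [pow_succ]
      noncomm_ring
  have hξ : ∀ a : ℕ, ξ ^ a * w - w * ξ ^ a ∈ degLT k γ ξ (j + a) := by
    intro a
    induction a with
    | zero => simp
    | succ a ih =>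
      have h1 := mul_pow_right_mem a (right_commutator_mem hc hw)
      have h2 := right_mul_mem hc ih
      convert add_mem (mem_of_le h1 (by omega : j + 1 + a ≤ j + (a + 1))) h2 using 1
      rw [pow_succ']
      noncomm_ring
  induction hu using induct with
  | h0 => simp
  | hadd x y _ _ hx hy =>
    convert add_mem hx hy using 1
    noncomm_ring
  | hsmul c x _ hx =>
    convert Submodule.smul_mem _ c hx using 1
    rw [mul_smul_comm, smul_mul_assoc, smul_sub]
  | hm b l hl =>
    have h1 := pow_left_mul_mem b (hξ l)
    have h2 := mul_pow_right_mem l (hγ b)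
    convert mem_of_le (add_mem h1 h2) (by omega : j + l ≤ i + j) using 1
    noncomm_ring

end degLT

/-- A linear map that preserves the filtration `degLT` and is multiplicative on the associated
graded algebra. -/
structure IsGradedMul {k : Type u} [Field k] {B : Type v} [Ring B] [Algebra k B] (γ ξ : B)
    (T : B →ₗ[k] B) : Prop where
  map_mem : ∀ {r : ℕ} {u : B}, u ∈ degLT k γ ξ r → T u ∈ degLT k γ ξ r
  map_mul_sub : ∀ {i j : ℕ} {u w : B}, u ∈ degLT k γ ξ (i + 1) → w ∈ degLT k γ ξ (j + 1) →
    T (u * w) - T u * T w ∈ degLT k γ ξ (i + j)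

lemma IsGradedMul.comp {k : Type u} [Field k] {B : Type v} [Ring B] [Algebra k B] {γ ξ : B}
    {T T' : B →ₗ[k] B} (h' : IsGradedMul γ ξ T') (h : IsGradedMul γ ξ T) :
    IsGradedMul γ ξ (T' ∘ₗ T) where
  map_mem hu := h'.map_mem (h.map_mem hu)
  map_mul_sub hu hw := by
    have h1 := h'.map_mem (h.map_mul_sub hu hw)
    have h2 := h'.map_mul_sub (h.map_mem hu) (h.map_mem hw)
    convert add_mem h1 h2 using 1
    simp

/-- The elements of degree at most `r` in the tensor square. -/
def tensorDegLE (k : Type u) [Field k] {B : Type v} [Ring B] [Algebra k B] (γ ξ : B) (r : ℕ) :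
    Submodule k (B ⊗[k] B) :=
  Submodule.span k {t | ∃ i j : ℕ, i + j = r ∧ ∃ u ∈ degLT k γ ξ (i + 1), ∃ w ∈ degLT k γ ξ (j + 1),
    t = u ⊗ₜ w}

namespace IsRadfordPair

variable {k : Type u} [Field k] {B : Type v} [Ring B] [HopfAlgebra k B] {p : ℕ} {c : k} {γ ξ : B}

lemma antipode_pow (x : B) (n : ℕ) :
    HopfAlgebra.antipode k (x ^ n) = HopfAlgebra.antipode k x ^ n := by
  induction n with
  | zero => simp
  | succ n ih => rw [pow_succ, HopfAlgebra.antipode_mul_antidistrib, ih, pow_succ']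

lemma sweedlerPower_apply_one (m : ℕ) : sweedlerPower k B m 1 = 1 := by
  induction m with
  | zero => simp [sweedlerPower]
  | succ m ih => simp [sweedlerPower, Algebra.TensorProduct.one_def, ih]

lemma tmul_mem {i j r : ℕ} (hr : i + j ≤ r) {u w : B} (hu : u ∈ degLT k γ ξ (i + 1))
    (hw : w ∈ degLT k γ ξ (j + 1)) : u ⊗ₜ w ∈ tensorDegLE k γ ξ r :=
  Submodule.subset_span ⟨i, r - i, by omega, u, hu, w, degLT.mem_of_le hw (by omega), rfl⟩

section
variable (h : IsRadfordPair k p c γ ξ)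
include h

lemma tensorDegLE_mul {r s : ℕ} {t t' : B ⊗[k] B} (ht : t ∈ tensorDegLE k γ ξ r)
    (ht' : t' ∈ tensorDegLE k γ ξ s) : t * t' ∈ tensorDegLE k γ ξ (r + s) := by
  induction ht using Submodule.span_induction with
  | zero => simp
  | add x y _ _ hx hy => rw [add_mul]; exact add_mem hx hy
  | smul a x _ hx => rw [smul_mul_assoc]; exact Submodule.smul_mem _ _ hx
  | mem x hx =>
    obtain ⟨i, j, hij, u, hu, w, hw, rfl⟩ := hx
    induction ht' using Submodule.span_induction with
    | zero => simp
    | add x y _ _ hx hy => rw [mul_add]; exact add_mem hx hy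
    | smul a x _ hx => rw [mul_smul_comm]; exact Submodule.smul_mem _ _ hx
    | mem x hx =>
      obtain ⟨i', j', hij', u', hu', w', hw', rfl⟩ := hx
      rw [Algebra.TensorProduct.tmul_mul_tmul]
      exact tmul_mem (i := i + i') (j := j + j') (by omega)
        (degLT.mem_of_le (degLT.mul_mem h.comm hu hu') (by omega))
        (degLT.mem_of_le (degLT.mul_mem h.comm hw hw') (by omega))

lemma comul_mem {r : ℕ} {u : B} (hu : u ∈ degLT k γ ξ (r + 1)) :
    comul (R := k) u ∈ tensorDegLE k γ ξ r := by
  have hγ : ∀ a : ℕ, comul (R := k) (γ ^ a) ∈ tensorDegLE k γ ξ 0 := by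
    intro a
    rw [Bialgebra.comul_pow, h.comul_left, Algebra.TensorProduct.tmul_pow]
    exact tmul_mem (i := 0) (j := 0) (by omega) (degLT.pow_mem a) (degLT.pow_mem a)
  have hξ : ∀ j : ℕ, comul (R := k) (ξ ^ j) ∈ tensorDegLE k γ ξ j := by
    intro j
    induction j with
    | zero => simpa using hγ 0
    | succ j ih =>
      rw [pow_succ, Bialgebra.comul_mul]
      apply h.tensorDegLE_mul ih
      rw [h.comul_right]
      exact add_mem
        (tmul_mem (i := 1) (j := 0) (by omega) degLT.right_mem degLT.one_mem)
        (tmul_mem (i := 0) (j := 1) (by omega) degLT.left_mem degLT.right_mem)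
  induction hu using degLT.induct with
  | h0 => simp
  | hadd x y _ _ hx hy => rw [map_add]; exact add_mem hx hy
  | hsmul c x _ hx => rw [map_smul]; exact Submodule.smul_mem _ _ hx
  | hm b l hl =>
    have hm : ∀ {m n : ℕ}, m ≤ n → tensorDegLE k γ ξ m ≤ tensorDegLE k γ ξ n := by
      intro m n hmn
      refine Submodule.span_le.2 ?_
      rintro _ ⟨i, j, hij, u, hu, w, hw, rfl⟩
      exact tmul_mem (by omega) hu hw
    rw [Bialgebra.comul_mul]
    exact hm (by omega) (h.tensorDegLE_mul (hγ b) (hξ l))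

/-- The coproduct is multiplicative and filtered. What could prevent `P_{m+1} = Φ ∘ Δ` from being
multiplicative is the reordering of factors in `Φ`, and commutators lie in lower degree. -/
lemma isGradedMul_sweedlerPower (m : ℕ) : IsGradedMul γ ξ (sweedlerPower k B m) := by
  induction m with
  | zero =>
    constructor
    · intro r u hu
      cases r with
      | zero =>
        rw [degLT.zero_eq, Submodule.mem_bot] at hu
        simp [hu]
      | succ r =>
        rw [sweedlerPower, LinearMap.comp_apply, Algebra.linearMap_apply,
          Algebra.algebraMap_eq_smul_one]
        exact Submodule.smul_mem _ _ (degLT.mem_of_le degLT.one_mem (by omega))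
    · intro i j u w _ _
      simp [sweedlerPower]
  | succ m ih =>
    set Φ : B ⊗[k] B →ₗ[k] B := LinearMap.mul' k B ∘ₗ (sweedlerPower k B m).rTensor B with hΦ
    have hval : ∀ u : B, sweedlerPower k B (m + 1) u = Φ (comul u) := fun u => rfl
    have hΦt : ∀ u w : B, Φ (u ⊗ₜ w) = sweedlerPower k B m u * w := fun u w => by simp [hΦ]
    have hmem : ∀ {r : ℕ} {t : B ⊗[k] B}, t ∈ tensorDegLE k γ ξ r → Φ t ∈ degLT k γ ξ (r + 1) := by
      intro r t ht
      induction ht using Submodule.span_induction with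
      | zero => simp
      | add x y _ _ hx hy => rw [map_add]; exact add_mem hx hy
      | smul a x _ hx => rw [map_smul]; exact Submodule.smul_mem _ _ hx
      | mem x hx =>
        obtain ⟨i, j, rfl, u, hu, w, hw, rfl⟩ := hx
        rw [hΦt]
        exact degLT.mem_of_le (degLT.mul_mem h.comm (ih.map_mem hu) hw) (by omega)
    have hmul : ∀ {r s : ℕ} {t t' : B ⊗[k] B}, t ∈ tensorDegLE k γ ξ r →
        t' ∈ tensorDegLE k γ ξ s → Φ (t * t') - Φ t * Φ t' ∈ degLT k γ ξ (r + s) := by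
      intro r s t t' ht ht'
      induction ht using Submodule.span_induction with
      | zero => simp
      | add x y _ _ hx hy =>
        convert add_mem hx hy using 1
        simp only [add_mul, map_add]
        abel
      | smul a x _ hx =>
        convert Submodule.smul_mem _ a hx using 1
        simp only [smul_mul_assoc, map_smul, smul_sub]
      | mem x hx =>
        obtain ⟨i, j, rfl, u, hu, w, hw, rfl⟩ := hx
        induction ht' using Submodule.span_induction with
        | zero => simp
        | add x y _ _ hx hy =>
          convert add_mem hx hy using 1
          simp only [mul_add, map_add]
          abel
        | smul a x _ hx =>
          convert Submodule.smul_mem _ a hx using 1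
          simp only [mul_smul_comm, map_smul, smul_sub]
        | mem x hx =>
          obtain ⟨i', j', rfl, u', hu', w', hw', rfl⟩ := hx
          rw [Algebra.TensorProduct.tmul_mul_tmul, hΦt, hΦt, hΦt]
          -- `P_m(uu')ww' - P_m(u)wP_m(u')w'` splits into the defect of `P_m` times `ww'` (`h1`) and
          -- `P_m(u) [P_m(u'), w] w'` (`h2`).
          have h1 := degLT.mul_mem' h.comm (ih.map_mul_sub hu hu') (j := j + j')
            (degLT.mem_of_le (degLT.mul_mem h.comm hw hw') (by omega))
          have h2 := degLT.mul_mem' h.comm (degLT.mul_mem h.comm (ih.map_mem hu)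
            (degLT.mul_sub_mul_mem h.comm (ih.map_mem hu') hw)) hw'
          convert add_mem (degLT.mem_of_le h1 (by omega : _ ≤ i + j + (i' + j')))
            (degLT.mem_of_le h2 (by omega)) using 1
          noncomm_ring
    constructor
    · intro r u hu
      cases r with
      | zero =>
        rw [degLT.zero_eq, Submodule.mem_bot] at hu
        simp [hu]
      | succ r => rw [hval]; exact hmem (h.comul_mem hu)
    · intro i j u w hu hw
      rw [hval, hval, hval, Bialgebra.comul_mul]
      exact hmul (h.comul_mem hu) (h.comul_mem hw)

lemma sweedlerPower_left (m : ℕ) : sweedlerPower k B m γ = γ ^ m := by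
  induction m with
  | zero => simp [sweedlerPower, h.counit_left]
  | succ m ih => simp [sweedlerPower, h.comul_left, ih, pow_succ]

lemma sweedlerPower_right (m : ℕ) :
    sweedlerPower k B m ξ = (∑ l ∈ Finset.range m, γ ^ l) * ξ := by
  induction m with
  | zero => simp [sweedlerPower, h.counit_right]
  | succ m ih =>
    simp [sweedlerPower, h.comul_right, ih, h.sweedlerPower_left, Finset.sum_range_succ, add_mul]

end

variable [Fact p.Prime] (h : IsRadfordPair k p c γ ξ)
include h

lemma pow_pred_mul : γ ^ (p - 1) * γ = 1 := by
  rw [← pow_succ, Nat.sub_add_cancel (Fact.out : p.Prime).one_le, h.pow_eq]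

lemma mul_pow_pred : γ * γ ^ (p - 1) = 1 := by
  rw [← pow_succ', Nat.sub_add_cancel (Fact.out : p.Prime).one_le, h.pow_eq]

lemma antipode_left : HopfAlgebra.antipode k γ = γ ^ (p - 1) := by
  have h1 := HopfAlgebra.mul_antipode_rTensor_comul_apply (R := k) γ
  simp only [h.comul_left, h.counit_left, LinearMap.rTensor_tmul, LinearMap.mul'_apply,
    map_one] at h1
  calc HopfAlgebra.antipode k γ = HopfAlgebra.antipode k γ * (γ * γ ^ (p - 1)) := by
        rw [h.mul_pow_pred, mul_one]
    _ = _ := by rw [← mul_assoc, h1, one_mul]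

lemma antipode_right : HopfAlgebra.antipode k ξ = -(γ ^ (p - 1) * ξ) := by
  have h1 := HopfAlgebra.mul_antipode_rTensor_comul_apply (R := k) ξ
  simp only [h.comul_right, h.counit_right, map_add, LinearMap.rTensor_tmul, LinearMap.mul'_apply,
    map_zero, h.antipode_left, mul_one] at h1
  exact eq_neg_of_add_eq_zero_left h1

/-- An anti-homomorphism is a homomorphism modulo commutators, and these have lower degree. -/
lemma isGradedMul_antipode : IsGradedMul γ ξ (HopfAlgebra.antipode k (A := B)) := by
  have hmem : ∀ {r : ℕ} {u : B}, u ∈ degLT k γ ξ r →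
      HopfAlgebra.antipode k u ∈ degLT k γ ξ r := by
    intro r u hu
    induction hu using degLT.induct with
    | h0 => simp
    | hadd x y _ _ hx hy => rw [map_add]; exact add_mem hx hy
    | hsmul c x _ hx => rw [map_smul]; exact Submodule.smul_mem _ _ hx
    | hm b l hl =>
      have h1 : ∀ j : ℕ, (-(γ ^ (p - 1) * ξ)) ^ j ∈ degLT k γ ξ (j + 1) := by
        intro j
        induction j with
        | zero => simpa using degLT.one_mem
        | succ j ih =>
          rw [pow_succ]
          have h2 : -(γ ^ (p - 1) * ξ) ∈ degLT k γ ξ 2 :=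
            neg_mem (degLT.pow_left_mul_mem _ degLT.right_mem)
          exact degLT.mem_of_le (degLT.mul_mem h.comm ih h2) (by omega)
      rw [HopfAlgebra.antipode_mul_antidistrib, antipode_pow, antipode_pow, h.antipode_left,
        h.antipode_right, ← pow_mul]
      exact degLT.mem_of_le (degLT.mul_mem h.comm (h1 l) (degLT.pow_mem _)) (by omega)
  refine ⟨hmem, fun {i j u w} hu hw => ?_⟩
  rw [HopfAlgebra.antipode_mul_antidistrib]
  exact degLT.mem_of_le (degLT.mul_sub_mul_mem h.comm (hmem hw) (hmem hu)) (by omega)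

/-- The leading term of `S ∘ P_m` on monomials. -/
theorem antipode_sweedlerPower_monomial (m a j : ℕ) :
    HopfAlgebra.antipode k (sweedlerPower k B m (γ ^ a * ξ ^ j)) -
      γ ^ ((p - 1) * m * a) * (-∑ l ∈ Finset.range m, γ ^ ((p - 1) * (l + 1))) ^ j * ξ ^ j ∈
      degLT k γ ξ j := by
  set T : B →ₗ[k] B := HopfAlgebra.antipode k ∘ₗ sweedlerPower k B m with hT
  have hg : IsGradedMul γ ξ T := h.isGradedMul_antipode.comp (h.isGradedMul_sweedlerPower m)
  -- `γ ^ (p - 1)` plays the role of `γ⁻¹`. The element `M` is the leading coefficient of `S (P_m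
  -- ξ)`, from `P_m ξ = (1 + ⋯ + γ^(m-1)) ξ` and `S ξ = -γ⁻¹ ξ`.
  set M : B := -∑ l ∈ Finset.range m, γ ^ ((p - 1) * (l + 1)) with hM
  have hMmem : M ∈ degLT k γ ξ 1 := neg_mem (sum_mem fun l _ => degLT.pow_mem _)
  have hTγ : T γ = γ ^ ((p - 1) * m) := by
    rw [hT, LinearMap.comp_apply, h.sweedlerPower_left, antipode_pow, h.antipode_left, pow_mul]
  have hTξ : T ξ - M * ξ ∈ degLT k γ ξ 1 := by
    set N := ∑ l ∈ Finset.range m, γ ^ ((p - 1) * l) with hN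
    have hNmem : N ∈ degLT k γ ξ 1 := sum_mem fun l _ => degLT.pow_mem _
    have e1 : T ξ = -(γ ^ (p - 1) * ξ) * N := by
      rw [hT, LinearMap.comp_apply, h.sweedlerPower_right, HopfAlgebra.antipode_mul_antidistrib,
        h.antipode_right, map_sum, hN]
      congr 1
      refine Finset.sum_congr rfl fun l _ => ?_
      rw [antipode_pow, h.antipode_left, pow_mul]
    have e2 : M = -(γ ^ (p - 1) * N) := by
      rw [hM, hN, Finset.mul_sum]
      congr 1
      refine Finset.sum_congr rfl fun l _ => ?_
      rw [← pow_add]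
      congr 1
      ring
    have h1 := degLT.pow_left_mul_mem (p - 1)
      (degLT.right_commutator_mem h.comm hNmem)
    convert neg_mem h1 using 1
    rw [e1, e2]
    noncomm_ring
  have hpow : ∀ a : ℕ, T (γ ^ a) = γ ^ ((p - 1) * m * a) := by
    intro a
    induction a with
    | zero => simp [hT, sweedlerPower_apply_one]
    | succ a ih =>
      -- In degree zero there are no lower terms, so `T` is exactly multiplicative on powers of `γ`.
      have := hg.map_mul_sub (i := 0) (j := 0) (degLT.pow_mem a) degLT.left_mem
      rw [degLT.zero_eq, Submodule.mem_bot, sub_eq_zero] at this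
      rw [pow_succ, this, ih, hTγ, ← pow_add]
      congr 1
  change T (γ ^ a * ξ ^ j) - _ ∈ _
  induction j with
  | zero => simp [hpow, degLT.zero_eq]
  | succ j ih =>
    -- Four errors add up: the defect of multiplicativity, replacing `T ξ` by `M * ξ`, the induction
    -- hypothesis, and moving `M` past `ξ ^ j`.
    have h1 : T (γ ^ a * ξ ^ j * ξ) - T (γ ^ a * ξ ^ j) * T ξ ∈ degLT k γ ξ (j + 1) :=
      hg.map_mul_sub (degLT.monomial_mem a (Nat.lt_succ_self j)) degLT.right_mem
    have h2 := degLT.mul_mem h.comm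
      (hg.map_mem (degLT.monomial_mem a (Nat.lt_succ_self j))) hTξ
    have hMξ : M * ξ ∈ degLT k γ ξ (1 + 1) :=
      degLT.mem_of_le (degLT.mul_mem (i := 0) h.comm hMmem degLT.right_mem) (by omega)
    have h3 := degLT.mul_mem' h.comm ih hMξ
    have h4 : ξ ^ j * M - M * ξ ^ j ∈ degLT k γ ξ j := by
      have : ξ ^ j ∈ degLT k γ ξ (j + 1) := by
        simpa using degLT.monomial_mem (k := k) (γ := γ) (ξ := ξ) 0 (Nat.lt_succ_self j)
      exact degLT.mul_sub_mul_mem (j := 0) h.comm this hMmem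
    have h5 := degLT.pow_left_mul_mem ((p - 1) * m * a) (degLT.mul_mem' (j := 1) h.comm
      (degLT.mul_mem (i := 0) h.comm (degLT.pow_mem_one h.comm hMmem j) h4) degLT.right_mem)
    rw [zero_add] at h5
    convert add_mem (add_mem (add_mem h1 h2) h3) h5 using 1
    rw [pow_succ, pow_succ, ← mul_assoc (γ ^ a)]
    noncomm_ring

end IsRadfordPair

end

end RadfordIndicator

/-! ### Independence of the monomials and the trace of `S ∘ P_m` -/

namespace RadfordIndicator

noncomputable section

open Coalgebra

/-- The operator `b ↦ b₍₁₎ η(b₍₂₎)`. -/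
def slice {k : Type u} [Field k] {B : Type v} [Ring B] [HopfAlgebra k B] (η : B →ₗ[k] k) :
    B →ₗ[k] B :=
  (TensorProduct.rid k B).toLinearMap ∘ₗ η.lTensor B ∘ₗ comul

namespace IsRadfordPair

variable {k : Type u} [Field k] {B : Type v} [Ring B] [HopfAlgebra k B] {p : ℕ} {c : k} {γ ξ : B}

/-- The monomial basis vectors. -/
def monomial (p : ℕ) (γ ξ : B) (i : Fin p × ZMod p) : B := γ ^ i.2.val * ξ ^ (i.1 : ℕ)

variable (h : IsRadfordPair k p c γ ξ)
include h

lemma slice_pow (η : B →ₗ[k] k) (a : ℕ) : slice η (γ ^ a) = η (γ ^ a) • γ ^ a := by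
  simp [slice, h.comul_left]

lemma slice_mul_right (η : B →ₗ[k] k) (f : B) : slice η (f * ξ) =
    slice η f * ξ + slice (η ∘ₗ LinearMap.mulRight k ξ) f * γ := by
  have key : ∀ t : B ⊗[k] B, TensorProduct.rid k B (η.lTensor B (t * (ξ ⊗ₜ 1 + γ ⊗ₜ ξ))) =
      TensorProduct.rid k B (η.lTensor B t) * ξ +
      TensorProduct.rid k B ((η ∘ₗ LinearMap.mulRight k ξ).lTensor B t) * γ := by
    intro t
    induction t with
    | zero => simp
    | add s t hs ht => simp only [add_mul, map_add, hs, ht]; abel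
    | tmul u w => simp [mul_add]
  simp only [slice, LinearMap.comp_apply, LinearEquiv.coe_coe, Bialgebra.comul_mul, h.comul_right,
    key]

/-- The leading term is the part of the coproduct with no `ξ` in the right factor; every `ξ` placed
on the right lowers the degree on the left. -/
lemma slice_monomial (η : B →ₗ[k] k) (a j : ℕ) :
    slice η (γ ^ a * ξ ^ j) - η (γ ^ a) • (γ ^ a * ξ ^ j) ∈ degLT k γ ξ j := by
  induction j generalizing η with
  | zero => simp [h.slice_pow]
  | succ j ih =>
    have h1 := degLT.mul_pow_right_mem 1 (ih η)
    have h2 : slice (η ∘ₗ LinearMap.mulRight k ξ) (γ ^ a * ξ ^ j) ∈ degLT k γ ξ (j + 1) := by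
      have := add_mem (degLT.mem_of_le (ih (η ∘ₗ LinearMap.mulRight k ξ)) (Nat.le_succ j))
        (Submodule.smul_mem _ ((η ∘ₗ LinearMap.mulRight k ξ) (γ ^ a))
          (degLT.monomial_mem (k := k) (γ := γ) (ξ := ξ) a (Nat.lt_succ_self j)))
      rwa [sub_add_cancel] at this
    have h3 := degLT.mul_mem' (j := 0) h.comm h2 degLT.left_mem
    convert add_mem h1 h3 using 1
    rw [pow_succ, ← mul_assoc, h.slice_mul_right, pow_one, sub_mul, smul_mul_assoc]
    abel

/-- Once `η` kills `γ ^ a`, the leading part comes from the `j + 1` ways to put a single `ξ` in the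
right factor: the slice acts like a derivative in `ξ`. -/
lemma slice_monomial_succ {η : B →ₗ[k] k} {a : ℕ} (hη : η (γ ^ a) = 0) (j : ℕ) :
    slice η (γ ^ a * ξ ^ (j + 1)) - (((j + 1 : ℕ) : k) * η (γ ^ a * ξ)) • (γ ^ (a + 1) * ξ ^ j) ∈
      degLT k γ ξ j := by
  induction j with
  | zero => simp [h.slice_mul_right, h.slice_pow, hη, pow_succ]
  | succ j ih =>
    have h1 := degLT.mul_pow_right_mem 1 ih
    have h2 := degLT.mul_mem' (j := 0) h.comm
      (h.slice_monomial (η ∘ₗ LinearMap.mulRight k ξ) a (j + 1)) degLT.left_mem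
    have hξ : ξ ^ (j + 1) ∈ degLT k γ ξ (j + 1 + 1) := by
      simpa using degLT.monomial_mem (k := k) (γ := γ) (ξ := ξ) 0 (Nat.lt_succ_self (j + 1))
    have h3 := Submodule.smul_mem _ (η (γ ^ a * ξ))
      (degLT.pow_left_mul_mem a (degLT.left_commutator_mem h.comm hξ))
    convert sub_mem (add_mem h1 h2) h3 using 1
    rw [pow_succ ξ (j + 1), ← mul_assoc, h.slice_mul_right, pow_one, sub_mul, sub_mul]
    simp only [smul_mul_assoc, LinearMap.comp_apply, LinearMap.mulRight_apply, mul_sub, smul_sub]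
    push_cast
    rw [add_mul _ (1 : k), one_mul, add_smul, mul_assoc _ (ξ ^ j) ξ, ← pow_succ, pow_succ γ a]
    simp only [mul_assoc]
    abel

variable [Fact p.Prime]

lemma pow_val_natCast (n : ℕ) : γ ^ (n : ZMod p).val = γ ^ n := by
  rw [ZMod.val_natCast, ← pow_eq_pow_mod n h.pow_eq]

lemma monomial_natCast (n : ℕ) (j : Fin p) :
    monomial p γ ξ (j, (n : ZMod p)) = γ ^ n * ξ ^ (j : ℕ) := by
  rw [monomial, h.pow_val_natCast]

/-- Slicing with `η` lowers the degree by one and scales the top coefficients by `(r + 1) η(γ^a ξ)`,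
nonzero because `r + 1 < p`. Repetition reduces to the independence of the powers of `γ`. -/
lemma eq_zero_of_sum_mem [CharP k p]
    (hγ : LinearIndependent k fun a : ZMod p => γ ^ a.val) {η : B →ₗ[k] k}
    (hη : ∀ a : ℕ, η (γ ^ a) = 0) (hη' : ∀ a : ℕ, η (γ ^ a * ξ) ≠ 0) {r : ℕ} (hr : r < p)
    (x : ZMod p → k) (hx : ∑ a, x a • (γ ^ a.val * ξ ^ r) ∈ degLT k γ ξ r) : ∀ a, x a = 0 := by
  induction r generalizing x with
  | zero =>
    rw [degLT.zero_eq, Submodule.mem_bot] at hx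
    simp only [pow_zero, mul_one] at hx
    exact Fintype.linearIndependent_iff.1 hγ x hx
  | succ r ih =>
    have h1 : ∀ u ∈ degLT k γ ξ (r + 1), slice η u ∈ degLT k γ ξ r := by
      intro u hu
      induction hu using degLT.induct with
      | h0 => simp
      | hadd x y _ _ hx hy => rw [map_add]; exact add_mem hx hy
      | hsmul c x _ hx => rw [map_smul]; exact Submodule.smul_mem _ _ hx
      | hm b l hl =>
        cases l with
        | zero => simp [h.slice_pow, hη]
        | succ l =>
          have := h.slice_monomial_succ (hη b) l
          have h2 := Submodule.smul_mem _ (((l + 1 : ℕ) : k) * η (γ ^ b * ξ))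
            (degLT.monomial_mem (k := k) (γ := γ) (ξ := ξ) (b + 1) (by omega : l < r))
          have h3 := add_mem (degLT.mem_of_le this (by omega : l ≤ r)) h2
          rwa [sub_add_cancel] at h3
    have h2 : ∑ a : ZMod p, (x a * (((r + 1 : ℕ) : k) * η (γ ^ a.val * ξ))) •
        (γ ^ (a.val + 1) * ξ ^ r) ∈ degLT k γ ξ r := by
      have h3 : ∑ a : ZMod p, x a • (slice η (γ ^ a.val * ξ ^ (r + 1)) -
          (((r + 1 : ℕ) : k) * η (γ ^ a.val * ξ)) • (γ ^ (a.val + 1) * ξ ^ r)) ∈ degLT k γ ξ r :=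
        sum_mem fun a _ => Submodule.smul_mem _ _ (h.slice_monomial_succ (hη _) r)
      have h4 := sub_mem (h1 _ hx) h3
      convert h4 using 1
      rw [map_sum, ← Finset.sum_sub_distrib]
      refine Finset.sum_congr rfl fun a _ => ?_
      rw [map_smul, smul_sub, sub_sub_cancel, smul_smul]
    -- Multiplication by `γ⁻¹` undoes the shift from `a` to `a + 1` caused by the slice.
    have h3 := degLT.pow_left_mul_mem (p - 1) h2
    have h4 := ih (by omega) (fun a => x a * (((r + 1 : ℕ) : k) * η (γ ^ a.val * ξ))) (by
      convert h3 using 1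
      rw [Finset.mul_sum]
      refine Finset.sum_congr rfl fun a _ => ?_
      rw [mul_smul_comm, pow_succ' γ a.val, mul_assoc γ, ← mul_assoc (γ ^ (p - 1)),
        h.pow_pred_mul, one_mul])
    intro a
    have hr' : ((r + 1 : ℕ) : k) ≠ 0 := by
      rw [Ne, CharP.cast_eq_zero_iff k p]
      exact fun hd => absurd (Nat.le_of_dvd (Nat.succ_pos r) hd) (by omega)
    exact (mul_eq_zero.1 (h4 a)).resolve_right (mul_ne_zero hr' (hη' _))

/-- In a vanishing combination the top part equals minus terms of lower degree, so the coefficients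
vanish from the top degree downwards. -/
theorem linearIndependent_monomial [CharP k p]
    (hγ : LinearIndependent k fun a : ZMod p => γ ^ a.val) {η : B →ₗ[k] k}
    (hη : ∀ a : ℕ, η (γ ^ a) = 0) (hη' : ∀ a : ℕ, η (γ ^ a * ξ) ≠ 0) :
    LinearIndependent k (monomial p γ ξ) := by
  rw [Fintype.linearIndependent_iff]
  intro x hx
  let y : ℕ → ZMod p → k := fun j a => if hj : j < p then x (⟨j, hj⟩, a) else 0
  have hy : ∑ j ∈ Finset.range p, ∑ a, y j a • (γ ^ a.val * ξ ^ j) = 0 := by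
    rw [← hx, Fintype.sum_prod_type, Finset.sum_range]
    simp [y, monomial]
  have key : ∀ r ≤ p, ∑ j ∈ Finset.range r, ∑ a, y j a • (γ ^ a.val * ξ ^ j) = 0 →
      ∀ j < r, ∀ a, y j a = 0 := by
    intro r
    induction r with
    | zero => intro _ _ j hj; omega
    | succ r ih =>
      intro hr hs
      have h0 : ∀ a, y r a = 0 := by
        apply h.eq_zero_of_sum_mem hγ hη hη' (by omega : r < p)
        rw [Finset.sum_range_succ, add_comm] at hs
        rw [eq_neg_of_add_eq_zero_left hs]
        exact neg_mem (sum_mem fun j hj => sum_mem fun a _ => Submodule.smul_mem _ _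
          (degLT.monomial_mem _ (Finset.mem_range.1 hj)))
      intro j hj
      rcases Nat.lt_succ_iff_lt_or_eq.1 hj with hj | rfl
      · refine ih (by omega) ?_ j hj
        rw [Finset.sum_range_succ] at hs
        simpa [h0] using hs
      · exact h0
  rintro ⟨j, a⟩
  have := key p le_rfl hy j j.2 a
  simpa [y] using this

section Trace

variable (b : Module.Basis (Fin p × ZMod p) k B) (hb : ∀ i, b i = monomial p γ ξ i)
include hb

lemma repr_monomial (n : ℕ) (j : Fin p) :
    b.repr (γ ^ n * ξ ^ (j : ℕ)) = Finsupp.single (j, (n : ZMod p)) 1 := by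
  rw [← h.monomial_natCast, ← hb, b.repr_self]

lemma repr_eq_zero {j : Fin p} {u : B} (hu : u ∈ degLT k γ ξ j) (a : ZMod p) :
    b.repr u (j, a) = 0 := by
  induction hu using degLT.induct with
  | h0 => simp
  | hadd x y _ _ hx hy => simp [hx, hy]
  | hsmul c x _ hx => simp [hx]
  | hm n l hl =>
    rw [h.repr_monomial b hb n ⟨l, hl.trans j.2⟩, Finsupp.single_apply, if_neg]
    intro he
    have := congrArg (fun i : Fin p × ZMod p => (i.1 : ℕ)) he
    simp only at this
    omega

/-- For `u = γ^n` the sum counts the `a` mod `p` with `-ma + n = a`. There is one if `m + 1` is a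
unit mod `p`; otherwise there are `p` or none, which is zero in `k` either way. -/
lemma sum_repr_diag [CharP k p] (m : ℕ) (j : Fin p) {u : B} (hu : u ∈ degLT k γ ξ 1) :
    ∑ a : ZMod p, b.repr (γ ^ ((p - 1) * m * a.val) * u * ξ ^ (j : ℕ)) (j, a) =
      if p ∣ m + 1 then 0 else counit (R := k) u := by
  induction hu using degLT.induct with
  | h0 => simp
  | hadd x y _ _ hx hy =>
    simp only [mul_add, add_mul, map_add, Finsupp.add_apply, Finset.sum_add_distrib, hx, hy]
    split_ifs <;> simp
  | hsmul c x _ hx =>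
    simp only [mul_smul_comm, smul_mul_assoc, map_smul, Finsupp.smul_apply, ← Finset.smul_sum, hx]
    split_ifs <;> simp
  | hm n l hl =>
    obtain rfl : l = 0 := by omega
    have hp1 : ((p - 1 : ℕ) : ZMod p) = -1 := by
      rw [Nat.cast_sub (Fact.out : p.Prime).one_le]
      simp
    have e : ∀ a : ZMod p, b.repr (γ ^ ((p - 1) * m * a.val) * (γ ^ n * ξ ^ 0) * ξ ^ (j : ℕ)) (j, a) =
        if ((m + 1 : ℕ) : ZMod p) * a = n then 1 else 0 := by
      intro a
      rw [pow_zero, mul_one, ← pow_add, h.repr_monomial b hb, Finsupp.single_apply]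
      refine if_congr ?_ rfl rfl
      rw [Prod.mk.injEq]
      push_cast
      rw [hp1, ZMod.natCast_zmod_val]
      constructor
      · rintro ⟨-, he⟩
        linear_combination (-1 : ZMod p) * he
      · intro he
        exact ⟨rfl, by linear_combination (-1 : ZMod p) * he⟩
    have hcounit : counit (R := k) (γ ^ n * ξ ^ 0) = 1 := by simp [h.counit_left]
    rw [Finset.sum_congr rfl fun a _ => e a, hcounit]
    split_ifs with hd
    · have h0 : ((m + 1 : ℕ) : ZMod p) = 0 := (ZMod.natCast_eq_zero_iff _ _).2 hd
      simp only [h0, zero_mul]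
      rw [Finset.sum_const, Finset.card_univ, ZMod.card, nsmul_eq_mul, CharP.cast_eq_zero, zero_mul]
    · have h0 : ((m + 1 : ℕ) : ZMod p) ≠ 0 := fun h0 => hd ((ZMod.natCast_eq_zero_iff _ _).1 h0)
      rw [Finset.sum_eq_single (((m + 1 : ℕ) : ZMod p)⁻¹ * n)]
      · rw [if_pos (mul_inv_cancel_left₀ h0 _)]
      · intro a _ ha
        rw [if_neg]
        rintro he
        exact ha (by rw [← he, inv_mul_cancel_left₀ h0])
      · simp

theorem trace_antipode_sweedlerPower [CharP k p] (m : ℕ) :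
    LinearMap.trace k B (HopfAlgebra.antipode k ∘ₗ sweedlerPower k B m) =
      if p ∣ m + 1 then 0 else 1 := by
  set M : B := -∑ l ∈ Finset.range m, γ ^ ((p - 1) * (l + 1)) with hM
  have hMmem : M ∈ degLT k γ ξ 1 := neg_mem (sum_mem fun l _ => degLT.pow_mem _)
  have hMc : counit (R := k) M = -(m : k) := by simp [hM, h.counit_left]
  have hdiag : ∀ (j : Fin p) (a : ZMod p),
      b.repr ((HopfAlgebra.antipode k ∘ₗ sweedlerPower k B m) (b (j, a))) (j, a) =
      b.repr (γ ^ ((p - 1) * m * a.val) * M ^ (j : ℕ) * ξ ^ (j : ℕ)) (j, a) := by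
    intro j a
    rw [hb, ← sub_eq_zero, ← Finsupp.sub_apply, ← map_sub]
    exact h.repr_eq_zero b hb (h.antipode_sweedlerPower_monomial m a.val j) a
  rw [LinearMap.trace_eq_matrix_trace k b, Matrix.trace, Fintype.sum_prod_type]
  simp only [Matrix.diag_apply, LinearMap.toMatrix_apply, hdiag]
  rw [Finset.sum_congr rfl fun j _ =>
    h.sum_repr_diag b hb m j (degLT.pow_mem_one h.comm hMmem (j : ℕ))]
  split_ifs with hd
  · simp
  · simp only [Bialgebra.counit_pow, hMc]
    have hm : ((m + 1 : ℕ) : k) ≠ 0 := fun h0 => hd ((CharP.cast_eq_zero_iff k p _).1 h0)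
    -- The remaining geometric sum in `-m` is `((-m)^p - 1) / (-m - 1)`; Frobenius fixes integers,
    -- so numerator and denominator agree.
    rw [← Finset.sum_range fun j => (-(m : k)) ^ j]
    have hx : (-(m : k)) ^ p = -(m : k) := by
      have h1 := map_intCast (frobenius k p) (-(m : ℤ))
      rw [frobenius_def] at h1
      simpa using h1
    have hne : -(m : k) - 1 ≠ 0 := by
      intro h0
      apply hm
      push_cast
      linear_combination -h0
    apply mul_right_cancel₀ hne
    rw [geom_sum_mul, hx, one_mul]

end Trace

/-- The indicators of a Hopf algebra of dimension at most `p ^ 2` with a Radford pair. -/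
theorem indicator_eq [CharP k p] [Module.Finite k B] (hdim : Module.finrank k B ≤ p * p)
    (hγ : LinearIndependent k fun a : ZMod p => γ ^ a.val) {η : B →ₗ[k] k}
    (hη : ∀ a : ℕ, η (γ ^ a) = 0) (hη' : ∀ a : ℕ, η (γ ^ a * ξ) ≠ 0) {n : ℕ} (hn : 1 ≤ n) :
    indicator k B n = if p ∣ n then 0 else 1 := by
  have hli := h.linearIndependent_monomial hγ hη hη'
  have hcard : Fintype.card (Fin p × ZMod p) = p * p := by
    rw [Fintype.card_prod, Fintype.card_fin, ZMod.card]
  have hle := hli.fintype_card_le_finrank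
  have : Nonempty (Fin p × ZMod p) := ⟨(⟨0, (Fact.out : p.Prime).pos⟩, 0)⟩
  have ht := h.trace_antipode_sweedlerPower
    (basisOfLinearIndependentOfCardEqFinrank hli (by omega)) (by simp) (n - 1)
  rwa [Nat.sub_add_cancel hn] at ht

end IsRadfordPair

end

end RadfordIndicator

/-! ### Finite dimension, characters and extensions of `R(p)` -/

namespace RadfordIndicator

noncomputable section

open Coalgebra

namespace Radford

variable (k : Type u) [Field k] (p : ℕ) [Fact p.Prime]

omit [Fact p.Prime] in
lemma comm_smul : g k p * x k p - x k p * g k p = (1 : k) • (g k p ^ 2 - g k p) := by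
  rw [one_smul, comm]

omit [Fact p.Prime] in
lemma exists_mem_degLT (a : Radford k p) : ∃ r, a ∈ degLT k (g k p) (x k p) (r + 1) := by
  induction a using induct with
  | hk r =>
    refine ⟨0, ?_⟩
    rw [Algebra.algebraMap_eq_smul_one]
    exact Submodule.smul_mem _ _ degLT.one_mem
  | hg => exact ⟨0, degLT.left_mem⟩
  | hx => exact ⟨1, degLT.right_mem⟩
  | hadd a b ha hb =>
    obtain ⟨r, hr⟩ := ha
    obtain ⟨s, hs⟩ := hb
    exact ⟨r + s, add_mem (degLT.mem_of_le hr (by omega)) (degLT.mem_of_le hs (by omega))⟩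
  | hmul a b ha hb =>
    obtain ⟨r, hr⟩ := ha
    obtain ⟨s, hs⟩ := hb
    exact ⟨r + s, degLT.mem_of_le (degLT.mul_mem (comm_smul k p) hr hs) (by omega)⟩

lemma exists_x_pow_eq (j : ℕ) : ∃ i : Fin p, x k p ^ j = x k p ^ (i : ℕ) := by
  induction j using Nat.strong_induction_on with
  | h j ih =>
    by_cases hj : j < p
    · exact ⟨⟨j, hj⟩, rfl⟩
    · have hp := (Fact.out : p.Prime).two_le
      -- `x ^ p = x` lowers an exponent `j ≥ p` by `p - 1`.
      obtain ⟨i, hi⟩ := ih (j - p + 1) (by omega)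
      refine ⟨i, ?_⟩
      rw [← hi, pow_succ, ← congrArg (x k p ^ (j - p) * ·) (x_pow k p), ← pow_add,
        Nat.sub_add_cancel (by omega)]

lemma span_monomials : Submodule.span k (Set.range fun i : Fin p × Fin p =>
    g k p ^ (i.1 : ℕ) * x k p ^ (i.2 : ℕ)) = ⊤ := by
  rw [eq_top_iff]
  rintro a -
  obtain ⟨r, hr⟩ := exists_mem_degLT k p a
  induction hr using degLT.induct with
  | h0 => exact zero_mem _
  | hadd x y _ _ hx hy => exact add_mem hx hy
  | hsmul c x _ hx => exact Submodule.smul_mem _ _ hx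
  | hm a j hj =>
    obtain ⟨i, hi⟩ := exists_x_pow_eq k p j
    apply Submodule.subset_span
    refine ⟨(⟨a % p, Nat.mod_lt _ (Fact.out : p.Prime).pos⟩, i), ?_⟩
    simp only [hi]
    rw [← pow_eq_pow_mod a (g_pow k p)]

instance : Module.Finite k (Radford k p) :=
  ⟨⟨(Set.finite_range fun i : Fin p × Fin p =>
    g k p ^ (i.1 : ℕ) * x k p ^ (i.2 : ℕ)).toFinset, by
      rw [Set.Finite.coe_toFinset, span_monomials]⟩⟩

/-- Only this bound is needed: the `p²` independent monomials in the dual supply the reverse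
inequality. -/
lemma finrank_le : Module.finrank k (Radford k p) ≤ p * p := by
  have h := finrank_range_le_card (R := k) fun i : Fin p × Fin p =>
    g k p ^ (i.1 : ℕ) * x k p ^ (i.2 : ℕ)
  rw [Set.finrank, span_monomials, finrank_top] at h
  simpa using h

variable {k p} [CharP k p]

lemma pow_unipotent (n : ℕ) : (!![1, 1; 0, 1] : Matrix (Fin 2) (Fin 2) k) ^ n = !![1, (n : k); 0, 1] := by
  induction n with
  | zero => ext i j; fin_cases i <;> fin_cases j <;> simp
  | succ n ih => rw [pow_succ, ih, Matrix.mul_fin_two]; simp [add_comm]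

lemma sub_one_pow_eq {i : k} (hi : i ^ p = i) : (i - 1) ^ p = i - 1 := by
  rw [sub_pow_char, hi, one_pow]

/-- The character `g ↦ 1`, `x ↦ i`. -/
def character (i : k) (hi : i ^ p = i) : Radford k p →ₐ[k] k :=
  lift 1 i (one_pow p) hi (by simp)

/-- The non-split extension of the character `x ↦ i` by the character `x ↦ i - 1`. -/
def extension (i : k) (hi : i ^ p = i) : Radford k p →ₐ[k] Matrix (Fin 2) (Fin 2) k :=
  lift !![1, 1; 0, 1] !![i - 1, 0; 0, i]
    (by rw [pow_unipotent, CharP.cast_eq_zero, Matrix.one_fin_two])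
    (by
      have h : (!![i - 1, 0; 0, i] : Matrix (Fin 2) (Fin 2) k) = Matrix.diagonal ![i - 1, i] := by
        ext a b; fin_cases a <;> fin_cases b <;> simp
      rw [h, Matrix.diagonal_pow]
      congr 1
      ext a; fin_cases a <;> simp [hi, sub_one_pow_eq hi])
    (by
      rw [pow_unipotent]
      ext a b; fin_cases a <;> fin_cases b <;> simp
      ring)

lemma extension_apply (i : k) (hi : i ^ p = i) (a : Radford k p) :
    extension i hi a 0 0 = character (i - 1) (sub_one_pow_eq hi) a ∧ extension i hi a 1 0 = 0 ∧
      extension i hi a 1 1 = character i hi a := by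
  induction a using induct with
  | hk r => simp [Matrix.algebraMap_matrix_apply]
  | hg => simp [extension, character]
  | hx => simp [extension, character]
  | hadd a b ha hb => simp [ha, hb]
  | hmul a b ha hb => simp [Matrix.mul_apply, Fin.sum_univ_two, ha, hb]

lemma extension_mul_apply (i : k) (hi : i ^ p = i) (a b : Radford k p) :
    extension i hi (a * b) 0 1 = extension i hi a 0 1 * character i hi b +
      character (i - 1) (sub_one_pow_eq hi) a * extension i hi b 0 1 := by
  simp [Matrix.mul_apply, Fin.sum_univ_two, extension_apply, add_comm]

end Radford

/-! ### Hopf algebras isomorphic to `R(p)` as algebras -/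

section AlgebraIso

variable {k : Type u} [Field k] {p : ℕ} [Fact p.Prime] [CharP k p]
  {K : Type v} [Ring K] [HopfAlgebra k K]

omit [Fact p.Prime] [CharP k p] in
/-- A functional that is a skew derivation with respect to two functionals is determined by its
values on the generators. -/
lemma skewDerivation_eq_zero (φ : Radford k p ≃ₐ[k] K) {ζ α β : K →ₗ[k] k}
    (hζ : ∀ a b, ζ (a * b) = ζ a * β b + α a * ζ b) (h1 : ζ 1 = 0)
    (hg : ζ (φ (Radford.g k p)) = 0) (hx : ζ (φ (Radford.x k p)) = 0) : ζ = 0 := by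
  ext a
  obtain ⟨a, rfl⟩ := φ.surjective a
  induction a using Radford.induct with
  | hk r => simp [Algebra.algebraMap_eq_smul_one, h1]
  | hg => exact hg
  | hx => exact hx
  | hadd a b ha hb => rw [map_add, map_add, ha, hb]; simp
  | hmul a b ha hb => rw [map_mul, hζ, ha, hb]; simp

variable [Module.Finite k K]

namespace ConvDual

lemma ev_mul_of_comul_left {f : ConvDual k K} (hf : comul (R := k) f = f ⊗ₜ f) (a b : K) :
    ev k K f (a * b) = ev k K f a * ev k K f b := by
  rw [← pair_comul, hf, pair_tmul]

/-- The value is a `p`-th root of unity, and in characteristic `p` the only one is `1`. -/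
lemma ev_g (φ : Radford k p ≃ₐ[k] K) {f : ConvDual k K} (hf : comul (R := k) f = f ⊗ₜ f)
    (h1 : counit (R := k) f = 1) : ev k K f (φ (Radford.g k p)) = 1 := by
  have hpow : ∀ (a : K) (n : ℕ), ev k K f (a ^ n) = ev k K f a ^ n := by
    intro a n
    induction n with
    | zero => rw [pow_zero, pow_zero, ← counit_eq, h1]
    | succ n ih => rw [pow_succ, pow_succ, ev_mul_of_comul_left hf, ih]
  have h := hpow (φ (Radford.g k p)) p
  rw [← map_pow, Radford.g_pow, map_one, ← counit_eq, h1] at h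
  rw [← sub_eq_zero]
  apply eq_zero_of_pow_eq_zero (n := p)
  rw [sub_pow_char, ← h, one_pow, sub_self]

/-- The difference of two characters is a skew-derivation with respect to them, and it already
vanishes at `1` and at the image of `g`. -/
lemma groupLike_ext (φ : Radford k p ≃ₐ[k] K) {f f' : ConvDual k K}
    (hf : comul (R := k) f = f ⊗ₜ f) (h1 : counit (R := k) f = 1)
    (hf' : comul (R := k) f' = f' ⊗ₜ f') (h1' : counit (R := k) f' = 1)
    (hx : ev k K f (φ (Radford.x k p)) = ev k K f' (φ (Radford.x k p))) : f = f' := by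
  apply ext_ev
  intro a
  rw [← sub_eq_zero, ← LinearMap.sub_apply]
  suffices h : ev k K f - ev k K f' = 0 by rw [h, LinearMap.zero_apply]
  apply skewDerivation_eq_zero φ (α := ev k K f) (β := ev k K f')
  · intro a b
    simp only [LinearMap.sub_apply, ev_mul_of_comul_left hf, ev_mul_of_comul_left hf']
    ring
  · rw [LinearMap.sub_apply, ← counit_eq, ← counit_eq, h1, h1', sub_self]
  · rw [LinearMap.sub_apply, ev_g φ hf h1, ev_g φ hf' h1', sub_self]
  · rw [LinearMap.sub_apply, hx, sub_self]

end ConvDual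

end AlgebraIso

end

end RadfordIndicator

/-! ### A Radford pair in the dual of `K` -/

namespace RadfordIndicator

noncomputable section

open Coalgebra

namespace AlgebraIso

open ConvDual

variable {k : Type u} [Field k] {p : ℕ} [Fact p.Prime] [CharP k p]
  {K : Type v} [Ring K] [HopfAlgebra k K] (φ : Radford k p ≃ₐ[k] K)

/-- The value of the counit of `K` at the generator `x`. -/
def counitValue : k := counit (R := k) (φ (Radford.x k p))

omit [Fact p.Prime] [CharP k p] in
lemma counitValue_pow : counitValue φ ^ p = counitValue φ := by
  rw [counitValue, ← Bialgebra.counit_pow, ← map_pow, Radford.x_pow]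

/-- The group-like element of the dual given by the character `g ↦ 1`, `x ↦ ε(x) - 1`. -/
def groupLike : ConvDual k K :=
  (ev k K).symm ((Radford.character (counitValue φ - 1)
    (Radford.sub_one_pow_eq (counitValue_pow φ))).toLinearMap ∘ₗ φ.symm.toLinearMap)

/-- The skew-primitive element of the dual given by an extension of the counit by `groupLike`. -/
def skewPrimitive : ConvDual k K :=
  (ev k K).symm (Matrix.entryLinearMap k k 0 1 ∘ₗ
    (Radford.extension (counitValue φ) (counitValue_pow φ)).toLinearMap ∘ₗ φ.symm.toLinearMap)

lemma ev_groupLike (a : K) : ev k K (groupLike φ) a = Radford.character (counitValue φ - 1)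
    (Radford.sub_one_pow_eq (counitValue_pow φ)) (φ.symm a) := by
  simp [groupLike]

lemma ev_skewPrimitive (a : K) : ev k K (skewPrimitive φ) a =
    Radford.extension (counitValue φ) (counitValue_pow φ) (φ.symm a) 0 1 := by
  simp [skewPrimitive]

/-- This makes the lower diagonal entry of the chosen extension the unit of the dual, whence the `1`
in the coproduct of `skewPrimitive`. -/
lemma character_counitValue (a : K) :
    Radford.character (counitValue φ) (counitValue_pow φ) (φ.symm a) = counit (R := k) a := by
  have h : Radford.character (counitValue φ) (counitValue_pow φ) =
      (Bialgebra.counitAlgHom k K).comp φ.toAlgHom := by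
    apply Radford.algHom_ext
    · have hg : counit (R := k) (φ (Radford.g k p)) ^ p = 1 := by
        rw [← Bialgebra.counit_pow, ← map_pow, Radford.g_pow, map_one, Bialgebra.counit_one]
      have : counit (R := k) (φ (Radford.g k p)) = 1 := by
        rw [← sub_eq_zero]
        apply eq_zero_of_pow_eq_zero (n := p)
        rw [sub_pow_char, hg, one_pow, sub_self]
      simp [Radford.character, this]
    · simp [Radford.character, counitValue]
  rw [h]
  simp

local notation "γ" => groupLike φ
local notation "ξ" => skewPrimitive φ
local notation "G" => φ (Radford.g k p)
local notation "X" => φ (Radford.x k p)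

lemma ev_skewPrimitive_g : ev k K ξ G = 1 := by
  simp [ev_skewPrimitive, Radford.extension]

lemma ev_groupLike_x : ev k K γ X = ev k K (γ ^ 0) X - 1 := by
  simp [ev_groupLike, Radford.character, counitValue]

variable [Module.Finite k K]

lemma comul_groupLike : comul (R := k) (groupLike φ) = groupLike φ ⊗ₜ groupLike φ := by
  apply pair_ext
  intro a b
  rw [pair_comul, pair_tmul]
  simp [ev_groupLike]

lemma counit_groupLike : counit (R := k) (groupLike φ) = 1 := by
  simp [counit_eq, ev_groupLike]

lemma comul_skewPrimitive : comul (R := k) (skewPrimitive φ) =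
    skewPrimitive φ ⊗ₜ 1 + groupLike φ ⊗ₜ skewPrimitive φ := by
  apply pair_ext
  intro a b
  rw [pair_comul, map_add, pair_tmul, pair_tmul]
  simp only [ev_groupLike, ev_skewPrimitive, ev_one, map_mul φ.symm, Radford.extension_mul_apply,
    character_counitValue]

lemma counit_skewPrimitive : counit (R := k) (skewPrimitive φ) = 0 := by
  simp [counit_eq, ev_skewPrimitive]

lemma comul_pow_groupLike (a : ℕ) : comul (R := k) (γ ^ a) = (γ ^ a) ⊗ₜ (γ ^ a) := by
  rw [Bialgebra.comul_pow, comul_groupLike, Algebra.TensorProduct.tmul_pow]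

lemma counit_pow_groupLike (a : ℕ) : counit (R := k) (γ ^ a) = 1 := by
  rw [Bialgebra.counit_pow, counit_groupLike, one_pow]

lemma ev_pow_g (a : ℕ) : ev k K (γ ^ a) G = 1 :=
  ev_g φ (comul_pow_groupLike φ a) (counit_pow_groupLike φ a)

lemma groupLike_mul_cancel {f f' : ConvDual k K} (a : ℕ) (h : γ ^ a * f = γ ^ a * f') :
    f = f' := by
  have h1 : HopfAlgebra.antipode k γ * γ = 1 := by
    have := HopfAlgebra.mul_antipode_rTensor_comul_apply (R := k) γ
    simpa [comul_groupLike, counit_groupLike] using this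
  induction a with
  | zero => simpa using h
  | succ a ih =>
    apply ih
    rw [pow_succ', mul_assoc, mul_assoc] at h
    simpa [← mul_assoc, h1] using congrArg (HopfAlgebra.antipode k γ * ·) h

/-- `ζ` is a `(β, α)`-skew-primitive element of the dual. -/
def IsSkew (α β ζ : ConvDual k K) : Prop := comul (R := k) ζ = ζ ⊗ₜ β + α ⊗ₜ ζ

lemma isSkew_left (a : ℕ) : IsSkew (γ ^ (a + 1)) (γ ^ a) (γ ^ a * ξ) := by
  rw [IsSkew, Bialgebra.comul_mul, comul_pow_groupLike, comul_skewPrimitive, mul_add,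
    Algebra.TensorProduct.tmul_mul_tmul, Algebra.TensorProduct.tmul_mul_tmul, mul_one, ← pow_succ]

lemma isSkew_right : IsSkew (γ ^ 2) (γ ^ 1) (ξ * γ) := by
  rw [IsSkew, Bialgebra.comul_mul, comul_groupLike, comul_skewPrimitive, add_mul,
    Algebra.TensorProduct.tmul_mul_tmul, Algebra.TensorProduct.tmul_mul_tmul, one_mul, ← pow_two,
    pow_one]

variable {φ}

omit [Fact p.Prime] [CharP k p] in
lemma IsSkew.ev_mul {α β ζ : ConvDual k K} (h : IsSkew α β ζ) (a b : K) :
    ev k K ζ (a * b) = ev k K ζ a * ev k K β b + ev k K α a * ev k K ζ b := by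
  rw [← pair_comul, h, map_add, pair_tmul, pair_tmul]

lemma IsSkew.ev_one {a b : ℕ} {ζ : ConvDual k K} (h : IsSkew (γ ^ a) (γ ^ b) ζ) :
    ev k K ζ 1 = 0 := by
  have h1 := h.ev_mul 1 1
  rw [← counit_eq (γ ^ a), ← counit_eq (γ ^ b), counit_pow_groupLike, counit_pow_groupLike,
    mul_one, mul_one, one_mul] at h1
  exact left_eq_add.1 h1

/-- Two skew-primitive elements of the same type are proportional up to a multiple of the trivial
one. -/
lemma IsSkew.eq_of_ev {a : ℕ} {ζ ζ' : ConvDual k K}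
    (h : IsSkew (γ ^ (a + 1)) (γ ^ a) ζ) (h' : IsSkew (γ ^ (a + 1)) (γ ^ a) ζ') {r s t : k}
    (hg : r * ev k K ζ G = s * ev k K ζ' G)
    (hx : r * ev k K ζ X = s * ev k K ζ' X +
      t * (ev k K (γ ^ (a + 1)) X - ev k K (γ ^ a) X)) :
    r • ζ = s • ζ' + t • (γ ^ (a + 1) - γ ^ a) := by
  rw [← sub_eq_zero]
  apply (ev k K).injective
  rw [map_zero]
  apply skewDerivation_eq_zero φ (α := ev k K (γ ^ (a + 1))) (β := ev k K (γ ^ a))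
  · intro b c
    simp only [map_sub, map_add, map_smul, LinearMap.sub_apply, LinearMap.add_apply,
      LinearMap.smul_apply, smul_eq_mul, h.ev_mul, h'.ev_mul,
      ev_mul_of_comul_left (comul_pow_groupLike φ _)]
    ring
  · simp only [map_sub, map_add, map_smul, LinearMap.sub_apply, LinearMap.add_apply,
      LinearMap.smul_apply, smul_eq_mul, h.ev_one, h'.ev_one, ← counit_eq (γ ^ _),
      counit_pow_groupLike]
    ring
  · simp only [map_sub, map_add, map_smul, LinearMap.sub_apply, LinearMap.add_apply,
      LinearMap.smul_apply, smul_eq_mul, ev_pow_g, hg]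
    ring
  · simp only [map_sub, map_add, map_smul, LinearMap.sub_apply, LinearMap.add_apply,
      LinearMap.smul_apply, smul_eq_mul, hx]
    ring

/-- Evaluating `ζ` on `gx - xg = g² - g` gives `ζ(g) (β(x) - α(x)) = ζ(g)`, since the characters `α
= γ^(a+1)` and `β = γ^a` are `1` at `g`. -/
lemma IsSkew.ev_x {a : ℕ} {ζ : ConvDual k K} (h : IsSkew (γ ^ (a + 1)) (γ ^ a) ζ)
    (h0 : ev k K ζ G ≠ 0) : ev k K (γ ^ (a + 1)) X = ev k K (γ ^ a) X - 1 := by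
  have h1 := congrArg (fun y => ev k K ζ (φ y)) (Radford.comm k p)
  simp only [map_sub, map_mul, pow_two, h.ev_mul, ev_pow_g] at h1
  apply mul_left_cancel₀ h0
  linear_combination -h1

variable (φ)

/-- If `γ^a ξ` vanished at `g`, then `d ξ` would be a multiple of `γ - 1`, with `d` the difference
of `γ^(a+1)` and `γ^a` at `x`. Evaluation at `g`, where `ξ` is `1`, forces `d = 0`, hence `γ = 1`;
but `γ` and `1` differ at `x`. -/
lemma ev_pow_mul_g_ne_zero (a : ℕ) : ev k K (γ ^ a * ξ) G ≠ 0 := by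
  intro h0
  set d : k := ev k K (γ ^ (a + 1)) X - ev k K (γ ^ a) X with hd
  have h1 := (isSkew_left φ a).eq_of_ev (isSkew_left φ a) (r := d) (s := 0)
    (t := ev k K (γ ^ a * ξ) X) (by simp [h0]) (by rw [← hd]; ring)
  have h2 : d • ξ = ev k K (γ ^ a * ξ) X • (γ - 1) := by
    apply groupLike_mul_cancel φ a
    rw [mul_smul_comm, h1, mul_smul_comm, mul_sub, mul_one, ← pow_succ, zero_smul, zero_add]
  have h3 := congrArg (fun f => ev k K f G) h2
  have h4 := ev_pow_g φ 1
  have h5 := ev_pow_g φ 0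
  rw [pow_one] at h4
  rw [pow_zero] at h5
  simp only [map_smul, map_sub, LinearMap.smul_apply, LinearMap.sub_apply, ev_skewPrimitive_g, h4,
    h5, sub_self, smul_eq_mul, mul_one, mul_zero] at h3
  have h6 : γ ^ (a + 1) = γ ^ a :=
    groupLike_ext φ (comul_pow_groupLike φ _) (counit_pow_groupLike φ _)
      (comul_pow_groupLike φ _) (counit_pow_groupLike φ _) (sub_eq_zero.1 (hd.symm.trans h3))
  have h7 : γ = 1 := by
    apply groupLike_mul_cancel φ a
    rw [mul_one, ← pow_succ, h6]
  have h8 := ev_groupLike_x φ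
  rw [pow_zero, h7] at h8
  exact one_ne_zero (sub_eq_self.1 h8.symm)

lemma ev_pow_x (a : ℕ) : ev k K (γ ^ a) X = counitValue φ - a := by
  induction a with
  | zero => simp [counitValue]
  | succ a ih =>
    rw [(isSkew_left φ a).ev_x (ev_pow_mul_g_ne_zero φ a), ih]
    push_cast
    ring

lemma groupLike_pow_eq_one : γ ^ p = 1 := by
  rw [← pow_zero γ]
  apply groupLike_ext φ (comul_pow_groupLike φ _) (counit_pow_groupLike φ _)
      (comul_pow_groupLike φ _) (counit_pow_groupLike φ _)
  rw [ev_pow_x, ev_pow_x]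
  simp

/-- Distinct characters are independent, and the values `ε(x) - a` at `x` separate the exponents mod
`p`. -/
lemma linearIndependent_pow : LinearIndependent k fun a : ZMod p => γ ^ a.val := by
  let f : ZMod p → (K →* k) := fun a =>
    { toFun := ev k K (γ ^ a.val)
      map_one' := by rw [← counit_eq, counit_pow_groupLike]
      map_mul' := ev_mul_of_comul_left (comul_pow_groupLike φ _) }
  have hf : Function.Injective f := by
    intro a b hab
    have h1 : ev k K (γ ^ a.val) X = ev k K (γ ^ b.val) X := DFunLike.congr_fun hab X
    rw [ev_pow_x, ev_pow_x, sub_right_inj] at h1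
    exact ZMod.val_injective p (CharP.natCast_injOn_Iio k p (ZMod.val_lt a) (ZMod.val_lt b) h1)
  have h := (linearIndependent_monoidHom K k).comp f hf
  exact LinearIndependent.of_comp (LinearMap.ltoFun k K k k ∘ₗ (ev k K).toLinearMap) h

/-- Evaluation at `g - 1`. -/
def evSub : ConvDual k K →ₗ[k] k := LinearMap.applyₗ (G - 1) ∘ₗ (ev k K).toLinearMap

lemma evSub_pow (a : ℕ) : evSub φ (γ ^ a) = 0 := by
  simp [evSub, ev_pow_g, ← counit_eq, counit_groupLike]

lemma evSub_pow_mul_ne_zero (a : ℕ) : evSub φ (γ ^ a * ξ) ≠ 0 := by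
  have h : evSub φ (γ ^ a * ξ) = ev k K (γ ^ a * ξ) G - ev k K (γ ^ a * ξ) 1 := by
    simp [evSub]
  rw [h, (isSkew_left φ a).ev_one, sub_zero]
  exact ev_pow_mul_g_ne_zero φ a

/-- `γξ` and `ξγ` are skew-primitive of the same type, hence proportional modulo `γ² - γ`. Their
ratio `r` satisfies `r ^ p = 1` because `γ ^ p = 1`, so `r = 1`. -/
lemma exists_comm : ∃ c : k, γ * ξ - ξ * γ = c • (γ ^ 2 - γ) := by
  have hξ := isSkew_left φ 1
  set r : k := ev k K (ξ * γ) G / ev k K (γ ^ 1 * ξ) G with hr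
  -- `t` corrects the value at `x`, where `γ² - γ` takes the value `-1`.
  set t : k := r * ev k K (γ ^ 1 * ξ) X - ev k K (ξ * γ) X with ht
  have h1 : ξ * γ = r • (γ * ξ) + t • (γ ^ 2 - γ) := by
    have := (isSkew_right φ).eq_of_ev hξ (r := 1) (s := r) (t := t)
      (by rw [one_mul, hr, div_mul_cancel₀ _ (ev_pow_mul_g_ne_zero φ 1)])
      (by rw [ev_pow_x, ev_pow_x, ht]; push_cast; ring)
    simpa using this
  -- The commutation relation is not yet known, so stability under right multiplication by `γ` is
  -- checked on powers of `γ` directly.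
  have hmul : ∀ u ∈ degLT k γ ξ 1, u * γ ∈ degLT k γ ξ 1 := by
    intro u hu
    induction hu using degLT.induct with
    | h0 => simp
    | hadd x y _ _ hx hy => rw [add_mul]; exact add_mem hx hy
    | hsmul c x _ hx => rw [smul_mul_assoc]; exact Submodule.smul_mem _ _ hx
    | hm b j hj =>
      obtain rfl : j = 0 := by omega
      rw [pow_zero, mul_one, ← pow_succ]
      exact degLT.pow_mem _
  have h2 : ∀ n : ℕ, ξ * γ ^ n - r ^ n • (γ ^ n * ξ) ∈ degLT k γ ξ 1 := by
    intro n
    induction n with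
    | zero => simp
    | succ n ih =>
      have h3 : γ ^ n * (t • (γ ^ 2 - γ)) ∈ degLT k γ ξ 1 :=
        degLT.pow_left_mul_mem n (Submodule.smul_mem _ _ (sub_mem (degLT.pow_mem 2) degLT.left_mem))
      convert add_mem (hmul _ ih) (Submodule.smul_mem _ (r ^ n) h3) using 1
      rw [sub_mul, smul_mul_assoc, mul_assoc (γ ^ n), h1, mul_add, smul_add, mul_smul_comm,
        smul_smul, ← mul_assoc (γ ^ n) γ, ← pow_succ, ← pow_succ, mul_assoc ξ, ← pow_succ]
      abel
  have h3 : ∀ u ∈ degLT k γ ξ 1, evSub φ u = 0 := by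
    intro u hu
    induction hu using degLT.induct with
    | h0 => simp
    | hadd x y _ _ hx hy => rw [map_add, hx, hy, add_zero]
    | hsmul c x _ hx => rw [map_smul, hx, smul_zero]
    | hm b j hj =>
      obtain rfl : j = 0 := by omega
      rw [pow_zero, mul_one, evSub_pow]
  -- For `n = p` the element `(1 - r^p) ξ` has degree zero; `evSub` kills degree zero but not `ξ`.
  have h4 := h3 _ (h2 p)
  have h5 := evSub_pow_mul_ne_zero φ 0
  rw [pow_zero, one_mul] at h5
  rw [groupLike_pow_eq_one, mul_one, one_mul, map_sub, map_smul, smul_eq_mul, ← one_sub_mul] at h4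
  have h6 := (mul_eq_zero.1 h4).resolve_right h5
  have h7 : r = 1 := by
    rw [← sub_eq_zero]
    apply eq_zero_of_pow_eq_zero (n := p)
    rw [sub_pow_char, one_pow, ← neg_sub, h6, neg_zero]
  refine ⟨-t, ?_⟩
  rw [h1, h7, one_smul, neg_smul]
  abel

lemma isRadfordPair : ∃ c : k, IsRadfordPair k p c γ ξ := by
  obtain ⟨c, hc⟩ := exists_comm φ
  exact ⟨c, comul_groupLike φ, comul_skewPrimitive φ, counit_groupLike φ, counit_skewPrimitive φ,
    groupLike_pow_eq_one φ, hc⟩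

/-- The indicators of a Hopf algebra that is isomorphic to `R(p)` as an algebra. -/
theorem indicator_eq (φ : Radford k p ≃ₐ[k] K) {n : ℕ} (hn : 1 ≤ n) : indicator k K n = if p ∣ n then 0 else 1 := by
  obtain ⟨c, h⟩ := isRadfordPair φ
  have hdim : Module.finrank k (ConvDual k K) ≤ p * p := by
    rw [(ev k K).finrank_eq]
    refine (Subspace.dual_finrank_eq (K := k) (V := K)).trans_le ?_
    rw [← φ.toLinearEquiv.finrank_eq]
    exact Radford.finrank_le k p
  rw [← ConvDual.indicator_eq]
  exact h.indicator_eq hdim (linearIndependent_pow φ) (evSub_pow φ) (evSub_pow_mul_ne_zero φ) hn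

end AlgebraIso

end

end RadfordIndicator

/-! ### Cyclic representations and the regular representation -/

namespace RadfordIndicator

noncomputable section

open CategoryTheory MonoidalCategory

namespace FinRep

section General

variable {k : Type u} [Field k] {H : Type v} [Ring H] [Algebra k H]

lemma act_mul_apply (X : FinRep k H) (a b : H) (v : X.V) :
    X.act (a * b) v = X.act a (X.act b v) := by
  rw [map_mul, Module.End.mul_apply]

lemma act_one_apply (X : FinRep k H) (v : X.V) : X.act 1 v = v := by
  rw [map_one, Module.End.one_apply]

/-- The underlying linear map of a morphism, as a linear map. -/
def linMap (X Y : FinRep k H) : (X ⟶ Y) →ₗ[k] (X.V →ₗ[k] Y.V) where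
  toFun f := f.lin
  map_add' _ _ := rfl
  map_smul' _ _ := rfl

lemma linMap_injective (X Y : FinRep k H) : Function.Injective (linMap X Y) :=
  fun _ _ h => hom_ext h

instance (X Y : FinRep k H) : Module.Finite k (X ⟶ Y) :=
  Module.Finite.of_injective _ (linMap_injective X Y)

/-- The underlying linear equivalence of an isomorphism. -/
def isoEquiv {X Y : FinRep k H} (e : X ≅ Y) : X.V ≃ₗ[k] Y.V :=
  LinearEquiv.ofLinearMap e.hom.lin e.inv.lin
    (by rw [← comp_lin, e.inv_hom_id, id_lin]) (by rw [← comp_lin, e.hom_inv_id, id_lin])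

lemma finrank_eq_of_iso {X Y : FinRep k H} (e : X ≅ Y) :
    Module.finrank k X.V = Module.finrank k Y.V :=
  (isoEquiv e).finrank_eq

/-- The one-dimensional representation given by a character. -/
def ofChar (χ : H →ₐ[k] k) : FinRep k H where
  V := k
  act := (Algebra.lmul k k).comp χ

lemma finrank_ofChar (χ : H →ₐ[k] k) : Module.finrank k (ofChar χ).V = 1 :=
  Module.finrank_self k

/-- An algebra acts on a one-dimensional representation through a character. -/
lemma exists_char {X : FinRep k H} (hX : Module.finrank k X.V = 1) :
    ∃ χ : H →ₐ[k] k, ∀ (h : H) (v : X.V), X.act h v = χ h • v := by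
  let e : X.V ≃ₗ[k] k := LinearEquiv.ofFinrankEq _ _ (by rw [hX, Module.finrank_self])
  have hact : ∀ (f : Module.End k X.V) (v : X.V), f v = e (f (e.symm 1)) • v := by
    intro f v
    have hv : v = e v • e.symm 1 := by
      apply e.injective
      simp
    apply e.injective
    conv_lhs => rw [hv]
    simp [mul_comm]
  refine ⟨AlgHom.ofLinearMap (e.toLinearMap ∘ₗ LinearMap.applyₗ (e.symm 1) ∘ₗ
    X.act.toLinearMap) (by simp) ?_, fun h v => hact (X.act h) v⟩
  intro a b
  change e (X.act (a * b) (e.symm 1)) = e (X.act a (e.symm 1)) * e (X.act b (e.symm 1))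
  rw [act_mul_apply, hact (X.act a)]
  simp

lemma exists_iso_ofChar {X : FinRep k H} (hX : Module.finrank k X.V = 1) :
    ∃ χ : H →ₐ[k] k, Nonempty (X ≅ ofChar χ) := by
  obtain ⟨χ, hχ⟩ := exists_char hX
  let e : X.V ≃ₗ[k] k := LinearEquiv.ofFinrankEq _ _ (by rw [hX, Module.finrank_self])
  refine ⟨χ, ⟨mkIso (Y := ofChar χ) e fun h => ?_⟩⟩
  ext v
  change e (X.act h v) = χ h * e v
  rw [hχ, map_smul, smul_eq_mul]

/-- The quotient of a representation by a stable subspace. -/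
def quotient (X : FinRep k H) (N : Submodule k X.V) (hN : ∀ h, N ≤ N.comap (X.act h)) :
    FinRep k H where
  V := X.V ⧸ N
  act := AlgHom.ofLinearMap
    { toFun := fun h => N.mapQ N (X.act h) (hN h)
      map_add' := fun a b => by ext v; simp
      map_smul' := fun c a => by ext v; simp }
    (by ext v; simp)
    (fun a b => by ext v; simp)

/-- The quotient map. -/
def quotientMap (X : FinRep k H) (N : Submodule k X.V) (hN : ∀ h, N ≤ N.comap (X.act h)) :
    X ⟶ X.quotient N hN where
  lin := N.mkQ
  equivariant h := by ext v; rfl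

variable (k H) in
/-- Every nonzero representation has a one-dimensional quotient. -/
def HasLineQuotients : Prop :=
  ∀ M : FinRep k H, Nontrivial M.V → ∃ (χ : H →ₐ[k] k) (f : M ⟶ ofChar χ), f ≠ 0

section Finite

variable [Module.Finite k H]

instance finite_algHom : Finite (H →ₐ[k] k) :=
  (linearIndependent_toLinearMap k H k).finite_of_isNoetherian

/-- A representation in which each character occurs at most once in the top is cyclic. -/
lemma exists_generator [Infinite k] (hH : HasLineQuotients k H) (P : FinRep k H)
    (hP : ∀ χ : H →ₐ[k] k, Module.finrank k (P ⟶ ofChar χ) ≤ 1) :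
    ∃ v : P.V, ∀ w : P.V, ∃ h : H, P.act h v = w := by
  let q : (H →ₐ[k] k) → Submodule k P.V := fun χ =>
    ⨅ f : P ⟶ ofChar χ, LinearMap.ker f.lin
  have hq : ∀ χ v, v ∈ q χ ↔ ∀ f : P ⟶ ofChar χ, f.lin v = 0 := by
    intro χ v
    simp [q]
  -- There are finitely many characters, and a vector space over an infinite field is not a finite
  -- union of proper subspaces.
  obtain ⟨v, hv⟩ : ∃ v : P.V, ∀ χ, q χ ≠ ⊤ → v ∉ q χ := by
    by_contra! hcon
    obtain ⟨⟨χ, hχ⟩, h⟩ := Subspace.exists_eq_top_of_iUnion_eq_univ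
      (ι := {χ : H →ₐ[k] k // q χ ≠ ⊤}) (p := fun χ => q χ.1) (by
        ext v
        obtain ⟨χ, hχ, hv⟩ := hcon v
        simp only [Set.mem_iUnion, Set.mem_univ, iff_true]
        exact ⟨⟨χ, hχ⟩, hv⟩)
    exact hχ h
  refine ⟨v, ?_⟩
  let N : Submodule k P.V := LinearMap.range (LinearMap.applyₗ v ∘ₗ P.act.toLinearMap)
  have hvN : ∀ h, P.act h v ∈ N := fun h => ⟨h, rfl⟩
  have hN : ∀ h, N ≤ N.comap (P.act h) := by
    rintro h _ ⟨a, rfl⟩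
    change P.act h (P.act a v) ∈ N
    rw [← act_mul_apply]
    exact hvN _
  suffices hNtop : N = ⊤ by
    intro w
    have hw : w ∈ N := hNtop ▸ Submodule.mem_top
    exact hw
  by_contra hne
  -- If `v` generates a proper subrepresentation, some nonzero map to a character kills `v`. All
  -- maps to that character are proportional, so they all kill `v`, against its choice.
  obtain ⟨χ, f, hf⟩ := hH (P.quotient N hN) (Submodule.Quotient.nontrivial_iff.2 hne)
  let f₁ : P ⟶ ofChar χ := P.quotientMap N hN ≫ f
  have hf₁ : f₁ ≠ 0 := by
    intro h0
    apply hf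
    apply hom_ext
    have h1 : f.lin ∘ₗ N.mkQ = 0 := congrArg Hom.lin h0
    exact (LinearMap.cancel_right N.mkQ_surjective).1 (h1.trans (LinearMap.zero_comp _).symm)
  have hf₁v : f₁.lin v = 0 := by
    have h1 : N.mkQ v = 0 := by
      rw [Submodule.mkQ_apply, Submodule.Quotient.mk_eq_zero]
      simpa [act_one_apply] using hvN 1
    change f.lin (N.mkQ v) = 0
    rw [h1]
    exact map_zero f.lin
  have hqχ : q χ ≠ ⊤ := by
    intro htop
    apply hf₁
    apply hom_ext
    ext w
    exact (hq χ w).1 (htop ▸ Submodule.mem_top) f₁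
  obtain ⟨f₂, hf₂⟩ : ∃ f₂ : P ⟶ ofChar χ, f₂.lin v ≠ 0 := by
    by_contra! hcon
    exact hv χ hqχ ((hq χ v).2 hcon)
  obtain ⟨f₀, hf₀⟩ := finrank_le_one_iff.1 (hP χ)
  obtain ⟨c₁, hc₁⟩ := hf₀ f₁
  obtain ⟨c₂, rfl⟩ := hf₀ f₂
  rw [← hc₁] at hf₁ hf₁v
  rw [smul_lin, LinearMap.smul_apply, smul_eq_zero] at hf₁v
  rcases hf₁v with h0 | h0
  · exact hf₁ (by rw [h0, zero_smul])
  · exact hf₂ (by rw [smul_lin, LinearMap.smul_apply, h0, smul_zero])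

variable (k H) in
/-- The regular representation, on a vector space in the universe of `k`. -/
def regular : FinRep k H where
  V := Fin (Module.finrank k H) → k
  act := ((Module.finBasis k H).equivFun.conjAlgEquiv k).toAlgHom.comp (Algebra.lmul k H)

variable (k H) in
/-- The identification of `H` with the underlying space of the regular representation. -/
def regEquiv : H ≃ₗ[k] (regular k H).V := (Module.finBasis k H).equivFun

lemma regular_act (a b : H) :
    (regular k H).act a (regEquiv k H b) = regEquiv k H (a * b) := by
  change regEquiv k H (a * (regEquiv k H).symm (regEquiv k H b)) = _
  rw [LinearEquiv.symm_apply_apply]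

lemma finrank_regular : Module.finrank k (regular k H).V = Module.finrank k H :=
  (regEquiv k H).finrank_eq.symm

/-- Morphisms out of the regular representation are elements. -/
def regularHomEquiv (Y : FinRep k H) : (regular k H ⟶ Y) ≃ₗ[k] Y.V where
  toFun f := f.lin (regEquiv k H 1)
  map_add' _ _ := rfl
  map_smul' _ _ := rfl
  invFun v :=
    { lin := LinearMap.applyₗ v ∘ₗ Y.act.toLinearMap ∘ₗ (regEquiv k H).symm.toLinearMap
      equivariant := fun h => by
        apply LinearMap.ext
        intro w
        obtain ⟨b, rfl⟩ := (regEquiv k H).surjective w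
        simp only [LinearMap.comp_apply, regular_act, LinearEquiv.coe_coe,
          LinearEquiv.symm_apply_apply]
        exact act_mul_apply Y h b v }
  left_inv f := by
    apply hom_ext
    apply LinearMap.ext
    intro w
    obtain ⟨b, rfl⟩ := (regEquiv k H).surjective w
    have h := equivariant_apply f b (regEquiv k H 1)
    rw [regular_act, mul_one] at h
    simp only [LinearMap.comp_apply, LinearEquiv.coe_coe, LinearEquiv.symm_apply_apply, h]
    rfl
  right_inv v := by
    simp only [LinearMap.comp_apply, LinearEquiv.coe_coe, LinearEquiv.symm_apply_apply]
    exact act_one_apply Y v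

lemma regularHomEquiv_symm_apply (Y : FinRep k H) (v : Y.V) (a : H) :
    ((regularHomEquiv Y).symm v).lin (regEquiv k H a) = Y.act a v := by
  change Y.act ((regEquiv k H).symm (regEquiv k H a)) v = _
  rw [LinearEquiv.symm_apply_apply]

lemma exists_surjective_of_generator {P : FinRep k H} {v : P.V}
    (hv : ∀ w : P.V, ∃ h : H, P.act h v = w) :
    ∃ f : regular k H ⟶ P, Function.Surjective f.lin := by
  refine ⟨(regularHomEquiv P).symm v, fun w => ?_⟩
  obtain ⟨h, rfl⟩ := hv w
  exact ⟨regEquiv k H h, regularHomEquiv_symm_apply P v h⟩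

omit [Module.Finite k H] in
lemma finrank_hom_le_of_surjective {X X' : FinRep k H} (s : X ⟶ X')
    (hs : Function.Surjective s.lin) (Y : FinRep k H) :
    Module.finrank k (X' ⟶ Y) ≤ Module.finrank k (X ⟶ Y) := by
  apply LinearMap.finrank_le_finrank_of_injective (f := Linear.leftComp k Y s)
  intro f g h
  apply hom_ext
  exact (LinearMap.cancel_right hs).1 (congrArg Hom.lin h)

variable (k H) in
/-- Endomorphisms of the regular representation are right multiplications. -/
def endRegularEquiv : (regular k H ⟶ regular k H) ≃ₗ[k] H :=
  (regularHomEquiv (regular k H)).trans (regEquiv k H).symm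

lemma regEquiv_endRegularEquiv (f : regular k H ⟶ regular k H) :
    regEquiv k H (endRegularEquiv k H f) = f.lin (regEquiv k H 1) :=
  (regEquiv k H).apply_symm_apply _

lemma endRegularEquiv_id : endRegularEquiv k H (𝟙 _) = 1 := by
  apply (regEquiv k H).injective
  rw [regEquiv_endRegularEquiv]
  rfl

lemma endRegularEquiv_comp (f g : regular k H ⟶ regular k H) :
    endRegularEquiv k H (f ≫ g) = endRegularEquiv k H f * endRegularEquiv k H g := by
  apply (regEquiv k H).injective
  have h := equivariant_apply g (endRegularEquiv k H f) (regEquiv k H 1)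
  rw [regular_act, mul_one, ← regEquiv_endRegularEquiv g, regular_act,
    regEquiv_endRegularEquiv] at h
  rw [← h, regEquiv_endRegularEquiv]
  rfl

end Finite

end General

end FinRep

end

end RadfordIndicator

namespace RadfordIndicator

noncomputable section

open CategoryTheory MonoidalCategory

namespace FinRep

/-! ### Equivalences that respect one-dimensional representations -/

section Equivalence

variable {k : Type u} [Field k] {H : Type v} [Ring H] [Algebra k H] {K : Type w} [Ring K]
  [Algebra k K]

/-- A functor between representation categories respects one-dimensional representations. -/
def PreservesLines (F : FinRep k H ⥤ FinRep k K) : Prop :=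
  ∀ X, Module.finrank k (F.obj X).V = 1 ↔ Module.finrank k X.V = 1

lemma PreservesLines.inverse {E : FinRep k H ≌ FinRep k K} (hE : PreservesLines E.functor) :
    PreservesLines E.inverse := by
  intro X
  have h : Module.finrank k (E.functor.obj (E.inverse.obj X)).V = Module.finrank k X.V :=
    finrank_eq_of_iso (E.counitIso.app X)
  rw [← hE, h]

/-- A fully faithful linear functor on morphism spaces. -/
def mapEquiv (F : FinRep k H ⥤ FinRep k K) [F.Additive] [F.Linear k] [F.Full] [F.Faithful]
    (X Y : FinRep k H) : (X ⟶ Y) ≃ₗ[k] (F.obj X ⟶ F.obj Y) :=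
  LinearEquiv.ofBijective (F.mapLinearMap k) ⟨F.map_injective, F.map_surjective⟩

lemma mapEquiv_apply (F : FinRep k H ⥤ FinRep k K) [F.Additive] [F.Linear k] [F.Full] [F.Faithful]
    {X Y : FinRep k H} (f : X ⟶ Y) : mapEquiv F X Y f = F.map f := rfl

/-- Composition with isomorphisms on morphism spaces. -/
def homCongr {X X' Y Y' : FinRep k H} (e : X ≅ X') (e' : Y ≅ Y') : (X ⟶ Y) ≃ₗ[k] (X' ⟶ Y') :=
  (Linear.homCongr k e e')

lemma eq_zero_of_subsingleton {X Y : FinRep k H} (hX : ¬Nontrivial X.V) (f : X ⟶ Y) : f = 0 := by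
  rw [not_nontrivial_iff_subsingleton] at hX
  apply hom_ext
  ext v
  rw [Subsingleton.elim v 0, map_zero, map_zero]

variable (E : FinRep k H ≌ FinRep k K) [E.functor.Additive] [E.functor.Linear k]

omit [E.functor.Linear k] in
lemma HasLineQuotients.of_equivalence (hH : HasLineQuotients k H)
    (hE : PreservesLines E.functor) : HasLineQuotients k K := by
  intro M hM
  have hN : Nontrivial (E.inverse.obj M).V := by
    by_contra hN
    have h1 : 𝟙 M = 0 := by
      apply E.inverse.map_injective
      rw [eq_zero_of_subsingleton hN (E.inverse.map (𝟙 M)), Functor.map_zero]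
    obtain ⟨v, hv⟩ := exists_ne (0 : M.V)
    exact hv (LinearMap.congr_fun (congrArg Hom.lin h1) v)
  obtain ⟨χ, f, hf⟩ := hH _ hN
  obtain ⟨ψ, ⟨e⟩⟩ := exists_iso_ofChar ((hE (ofChar χ)).2 (finrank_ofChar χ))
  refine ⟨ψ, (E.counitIso.app M).inv ≫ E.functor.map f ≫ e.hom, fun h0 => hf ?_⟩
  apply E.functor.map_injective
  rw [Functor.map_zero]
  have h1 := congrArg (fun t => (E.counitIso.app M).hom ≫ t ≫ e.inv) h0
  simpa using h1

/-- Through the equivalence these morphisms are those from the regular representation of `H` to a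
line, hence the elements of that line. -/
lemma finrank_map_regular_hom_ofChar_le [Module.Finite k H] (hE : PreservesLines E.functor)
    (ψ : K →ₐ[k] k) : Module.finrank k (E.functor.obj (regular k H) ⟶ ofChar ψ) ≤ 1 := by
  have h := (homCongr (Iso.refl (E.functor.obj (regular k H)))
    (E.counitIso.app (ofChar ψ)).symm).finrank_eq
  refine h.trans_le (((mapEquiv E.functor _ (E.inverse.obj (ofChar ψ))).finrank_eq.symm.trans
    ((regularHomEquiv _).finrank_eq.trans ?_)).le)
  rw [hE.inverse, finrank_ofChar]

lemma exists_surjective_regular [Infinite k] [Module.Finite k H] [Module.Finite k K]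
    (hK : HasLineQuotients k K) (hE : PreservesLines E.functor) :
    ∃ f : regular k K ⟶ E.functor.obj (regular k H), Function.Surjective f.lin := by
  obtain ⟨v, hv⟩ := exists_generator hK (E.functor.obj (regular k H))
    (finrank_map_regular_hom_ofChar_le E hE)
  exact exists_surjective_of_generator hv

lemma finrank_le_of_surjective [Module.Finite k H] [Module.Finite k K]
    (s : regular k H ⟶ E.inverse.obj (regular k K)) (hs : Function.Surjective s.lin) :
    Module.finrank k K ≤ Module.finrank k (E.inverse.obj (regular k K)).V := by
  calc Module.finrank k K = Module.finrank k (regular k K ⟶ regular k K) :=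
        (endRegularEquiv k K).finrank_eq.symm
    _ = Module.finrank k (E.inverse.obj (regular k K) ⟶ E.inverse.obj (regular k K)) :=
        (mapEquiv E.inverse _ _).finrank_eq
    _ ≤ Module.finrank k (regular k H ⟶ E.inverse.obj (regular k K)) :=
        finrank_hom_le_of_surjective s hs _
    _ = _ := (regularHomEquiv _).finrank_eq

/-- An equivalence that respects lines sends the regular representation to the regular
representation. -/
theorem exists_regular_iso [Infinite k] [Module.Finite k H] [Module.Finite k K]
    (hH : HasLineQuotients k H) (hE : PreservesLines E.functor) :
    Nonempty (regular k K ≅ E.functor.obj (regular k H)) := by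
  have hK := hH.of_equivalence E hE
  have : E.symm.functor.Additive := inferInstanceAs E.inverse.Additive
  have : E.symm.functor.Linear k := inferInstanceAs (E.inverse.Linear k)
  obtain ⟨f, hf⟩ := exists_surjective_regular E hK hE
  obtain ⟨f', hf'⟩ := exists_surjective_regular E.symm hH hE.inverse
  -- With `F` inverse to `E`, the chain `dim K ≤ dim F(K) ≤ dim H ≤ dim E(H) ≤ dim K` closes up, so
  -- the surjection `f` is an isomorphism.
  have h1 := finrank_le_of_surjective E f' hf'
  have h2 := finrank_le_of_surjective E.symm f hf
  have h3 := LinearMap.finrank_le_finrank_of_surjective hf'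
  have h4 := LinearMap.finrank_le_finrank_of_surjective hf
  rw [finrank_regular] at h3 h4
  have hfin : Module.finrank k (regular k K).V =
      Module.finrank k (E.functor.obj (regular k H)).V := by
    rw [finrank_regular]
    exact le_antisymm (h1.trans (h3.trans h2)) h4
  have hinj : Function.Injective f.lin :=
    (LinearMap.injective_iff_surjective_of_finrank_eq_finrank hfin).2 hf
  exact ⟨mkIso (LinearEquiv.ofBijective f.lin ⟨hinj, hf⟩) f.equivariant⟩

/-- Algebras with an equivalence of representation categories that respects lines are isomorphic. -/
theorem exists_algEquiv [Infinite k] [Module.Finite k H] [Module.Finite k K]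
    (hH : HasLineQuotients k H) (hE : PreservesLines E.functor) : Nonempty (H ≃ₐ[k] K) := by
  obtain ⟨θ⟩ := exists_regular_iso E hH hE
  let e : H ≃ₗ[k] K := (endRegularEquiv k H).symm.trans
    ((mapEquiv E.functor _ _).trans ((homCongr θ.symm θ.symm).trans (endRegularEquiv k K)))
  have he : ∀ f, e (endRegularEquiv k H f) =
      endRegularEquiv k K (θ.hom ≫ E.functor.map f ≫ θ.inv) := by
    intro f
    simp [e, homCongr, mapEquiv_apply, Linear.homCongr_apply]
  refine ⟨AlgEquiv.ofLinearEquiv e ?_ ?_⟩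
  · rw [← endRegularEquiv_id (k := k), he, E.functor.map_id, Category.id_comp, θ.hom_inv_id,
      endRegularEquiv_id]
  · intro a b
    obtain ⟨f, rfl⟩ := (endRegularEquiv k H).surjective a
    obtain ⟨g, rfl⟩ := (endRegularEquiv k H).surjective b
    rw [← endRegularEquiv_comp, he, he, he, ← endRegularEquiv_comp]
    congr 1
    simp

end Equivalence

/-! ### Lines as tensor-invertible representations -/

section Monoidal

variable {k : Type u} [Field k] {H : Type v} [Ring H] [HopfAlgebra k H] {K : Type w} [Ring K]
  [HopfAlgebra k K]

lemma finrank_unit : Module.finrank k (𝟙_ (FinRep k H)).V = 1 := Module.finrank_self k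

lemma finrank_eq_one_of_tensor_iso {X Y : FinRep k H} (e : X ⊗ Y ≅ 𝟙_ (FinRep k H)) :
    Module.finrank k X.V = 1 := by
  have h1 : Module.finrank k (X.V ⊗[k] Y.V) = 1 := (finrank_eq_of_iso e).trans finrank_unit
  rw [Module.finrank_tensorProduct] at h1
  exact Nat.eq_one_of_mul_eq_one_right h1

/-- A character composed with the antipode. -/
def antipodeChar (χ : H →ₐ[k] k) : H →ₐ[k] k :=
  AlgHom.ofLinearMap (χ.toLinearMap ∘ₗ HopfAlgebra.antipode k) (by simp) (fun a b => by
    simp [HopfAlgebra.antipode_mul_antidistrib, mul_comm])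

lemma lid_actTensor (χ : H →ₐ[k] k) (t : H ⊗[k] H) (a b : k) :
    TensorProduct.lid k k (actTensor ((Algebra.lmul k k).comp χ)
      ((Algebra.lmul k k).comp (antipodeChar χ)) t (a ⊗ₜ b)) =
      χ (LinearMap.mul' k H ((HopfAlgebra.antipode k).lTensor H t)) * (a * b) := by
  induction t with
  | zero => simp
  | add s t hs ht => simp only [map_add, LinearMap.add_apply, hs, ht, add_mul]
  | tmul s t =>
    have h : antipodeChar χ t = χ (HopfAlgebra.antipode k t) := rfl
    simp [h]
    ring

/-- The inverse of a character is its composite with the antipode. -/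
lemma exists_tensor_iso {X : FinRep k H} (hX : Module.finrank k X.V = 1) :
    ∃ Y : FinRep k H, Nonempty (X ⊗ Y ≅ 𝟙_ (FinRep k H)) := by
  obtain ⟨χ, ⟨i⟩⟩ := exists_iso_ofChar hX
  suffices h : Nonempty (ofChar χ ⊗ ofChar (antipodeChar χ) ≅ 𝟙_ (FinRep k H)) by
    obtain ⟨j⟩ := h
    exact ⟨_, ⟨whiskerRightIso i _ ≪≫ j⟩⟩
  refine ⟨mkIso (X := ofChar χ ⊗ ofChar (antipodeChar χ)) (Y := 𝟙_ (FinRep k H))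
    (TensorProduct.lid k k) fun h => ?_⟩
  apply TensorProduct.ext'
  intro a b
  refine (lid_actTensor χ (Coalgebra.comul h) a b).trans ?_
  rw [HopfAlgebra.mul_antipode_lTensor_comul_apply]
  simp only [AlgHom.commutes]
  rfl

/-- Being a line is the same as having a right tensor inverse, which a monoidal equivalence
preserves and reflects. -/
lemma preservesLines_of_monoidal (E : FinRep k H ≌ FinRep k K) [E.functor.Monoidal] :
    PreservesLines E.functor := by
  intro X
  constructor
  · intro hX
    obtain ⟨Z, ⟨i⟩⟩ := exists_tensor_iso hX
    have j : E.functor.obj (X ⊗ E.inverse.obj Z) ≅ E.functor.obj (𝟙_ (FinRep k H)) :=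
      (Functor.Monoidal.μIso E.functor X (E.inverse.obj Z)).symm ≪≫
        whiskerLeftIso _ (E.counitIso.app Z) ≪≫ i ≪≫ Functor.Monoidal.εIso E.functor
    exact finrank_eq_one_of_tensor_iso (E.functor.preimageIso j)
  · intro hX
    obtain ⟨Y, ⟨i⟩⟩ := exists_tensor_iso hX
    exact finrank_eq_one_of_tensor_iso (Functor.Monoidal.μIso E.functor X Y ≪≫
      E.functor.mapIso i ≪≫ (Functor.Monoidal.εIso E.functor).symm)

end Monoidal

end FinRep

/-! ### One-dimensional quotients over `R(p)` -/

namespace Radford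

open FinRep

/-- The quotient is given by a common eigenfunctional of `g` and `x`. As `g - 1` acts nilpotently,
functionals fixed by `g` exist; they are stable under `x`, which has an eigenvector among them over
an algebraically closed field. -/
lemma hasLineQuotients (k : Type u) [Field k] [IsAlgClosed k] (p : ℕ) [Fact p.Prime] [CharP k p] :
    HasLineQuotients k (Radford k p) := by
  intro M hM
  set a : Module.End k M.V := M.act (g k p) with ha
  set b : Module.End k M.V := M.act (x k p) with hb
  have hap : (a - 1) ^ p = 0 := by
    have : CharP (Module.End k M.V) p :=
      charP_of_injective_algebraMap (algebraMap k (Module.End k M.V)).injective p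
    rw [sub_pow_char_of_commute _ (Commute.one_right a), ha, ← map_pow, g_pow, map_one, one_pow,
      sub_self]
  have hbp : b ^ p = b := by rw [hb, ← map_pow, x_pow]
  have hab : a * b - b * a = a ^ 2 - a := by
    rw [ha, hb, ← map_mul, ← map_mul, ← map_sub, comm, map_sub, map_pow]
  let L : Submodule k (M.V →ₗ[k] k) := LinearMap.ker (LinearMap.lcomp k k (a - 1))
  have hL : ∀ f, f ∈ L ↔ f ∘ₗ (a - 1) = 0 := fun f => Iff.rfl
  have hLne : Nontrivial L := by
    rw [Submodule.nontrivial_iff_ne_bot]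
    intro hbot
    have hinj : ∀ f : M.V →ₗ[k] k, f ∘ₗ (a - 1) = 0 → f = 0 := by
      intro f hf
      have : f ∈ L := hf
      rwa [hbot, Submodule.mem_bot] at this
    have hpow : ∀ (n : ℕ) (f : M.V →ₗ[k] k), f ∘ₗ ((a - 1) ^ n : Module.End k M.V) = 0 →
        f = 0 := by
      intro n
      induction n with
      | zero => intro f hf; simpa [Module.End.one_eq_id] using hf
      | succ n ih =>
        intro f hf
        apply ih
        apply hinj
        rwa [pow_succ, Module.End.mul_eq_comp, ← LinearMap.comp_assoc] at hf
    obtain ⟨f, hf⟩ := exists_ne (0 : M.V →ₗ[k] k)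
    exact hf (hpow p f (by rw [hap, LinearMap.comp_zero]))
  have hstable : ∀ f ∈ L, LinearMap.lcomp k k b f ∈ L := by
    intro f hf
    -- The relation lets `a - 1` be moved to the left of `b`, where a functional in `L` kills it.
    have h1 : b * (a - 1) = (a - 1) * (b - a) := by
      have h2 : b * a = a * b - (a ^ 2 - a) := by rw [← hab]; abel
      rw [mul_sub, mul_one, h2]
      noncomm_ring
    rw [hL] at hf ⊢
    change f ∘ₗ (b * (a - 1) : Module.End k M.V) = 0
    rw [h1, Module.End.mul_eq_comp, ← LinearMap.comp_assoc, hf, LinearMap.zero_comp]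
  let T : Module.End k L := (LinearMap.lcomp k k b).restrict hstable
  obtain ⟨c, hc⟩ := Module.End.exists_eigenvalue (K := k) (V := L) T
  obtain ⟨⟨f, hfL⟩, hf⟩ := hc.exists_hasEigenvector
  have hf0 : f ≠ 0 := fun h0 => hf.2 (Subtype.ext h0)
  have hfb : ∀ v, f (b v) = c * f v := fun v =>
    LinearMap.congr_fun (congrArg Subtype.val hf.apply_eq_smul) v
  have hfa : ∀ v, f (a v) = f v := by
    intro v
    have := LinearMap.congr_fun ((hL f).1 hfL) v
    simpa [sub_eq_zero] using this
  have hcp : c ^ p = c := by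
    obtain ⟨v, hv⟩ : ∃ v, f v ≠ 0 := by
      by_contra! hcon
      exact hf0 (LinearMap.ext hcon)
    have hpow : ∀ n : ℕ, f ((b ^ n) v) = c ^ n * f v := by
      intro n
      induction n with
      | zero => simp
      | succ n ih => rw [pow_succ', Module.End.mul_apply, hfb, ih, pow_succ', mul_assoc]
    apply mul_right_cancel₀ hv
    rw [← hpow, hbp, hfb]
  have hequi : ∀ (r : Radford k p) (v : M.V), f (M.act r v) = character c hcp r * f v := by
    intro r
    induction r using induct with
    | hk r => intro v; simp [Algebra.algebraMap_eq_smul_one]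
    | hg => intro v; rw [← ha, hfa]; simp [character]
    | hx => intro v; rw [← hb, hfb]; simp [character]
    | hadd r s hr hs => intro v; simp [hr, hs, add_mul]
    | hmul r s hr hs => intro v; rw [act_mul_apply, hr, hs, map_mul, mul_assoc]
  refine ⟨character c hcp, ⟨f, fun r => LinearMap.ext (hequi r)⟩, fun h0 => hf0 ?_⟩
  exact congrArg Hom.lin h0

end Radford

end

end RadfordIndicator

theorem theoremT {k : Type u} [Field k] [IsAlgClosed k] (p : ℕ) [Fact p.Prime] [CharP k p] :
    Module.Finite k (RadfordIndicator.Radford k p) ∧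
    (∀ n : ℕ, 1 ≤ n →
      RadfordIndicator.indicator k (RadfordIndicator.Radford k p) n = if p ∣ n then 0 else 1) ∧
    (∀ n : ℕ, 1 ≤ n →
      RadfordIndicator.indicator k (RadfordIndicator.Radford k p) (n + p) =
        RadfordIndicator.indicator k (RadfordIndicator.Radford k p) n) ∧
    (∀ (K : Type v) [Ring K] [HopfAlgebra k K] [Module.Finite k K],
      RadfordIndicator.GaugeEquivalent k (RadfordIndicator.Radford k p) K →
        ∀ n : ℕ, 1 ≤ n →
          RadfordIndicator.indicator k K n =
            RadfordIndicator.indicator k (RadfordIndicator.Radford k p) n) := by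
  have hR : ∀ n : ℕ, 1 ≤ n →
      RadfordIndicator.indicator k (RadfordIndicator.Radford k p) n = if p ∣ n then 0 else 1 :=
    fun n hn => RadfordIndicator.AlgebraIso.indicator_eq AlgEquiv.refl hn
  refine ⟨inferInstance, hR, fun n hn => ?_, ?_⟩
  · simp only [hR _ (le_add_right hn), hR n hn, Nat.dvd_add_self_right]
  · rintro K _ _ _ ⟨E, _, _, ⟨_⟩⟩ n hn
    have : Infinite k := IsAlgClosed.instInfinite
    obtain ⟨φ⟩ := RadfordIndicator.FinRep.exists_algEquiv E
      (RadfordIndicator.Radford.hasLineQuotients k p)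
      (RadfordIndicator.FinRep.preservesLines_of_monoidal E)
    rw [hR n hn, RadfordIndicator.AlgebraIso.indicator_eq φ hn]
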